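/- Let $d\in\mathbb N$, let $\mathcal P(\mathbb R^d)$ be the set of Borel probability measures on $\mathbb R^d$ and $\mathbb S^d_{++}$ the set of symmetric positive definite real $d\times d$ matrices. For $i=(x,\Sigma)\in I:=\mathbb R^d\times\mathbb S^d_{++}$ let $\mu_i=\mathcal N(x;\Sigma)$ be the Gaussian with mean $x$ and covariance matrix $\Sigma$, and put $\mathcal G=\{\mu_i : i\in I\}$. Let $W_2$ be the 2-Wasserstein distance (infimum of the quadratic cost over couplings, possibly $\infty$). For an absolutely continuous base measure $\mu_0$ with finite second moment and for $\nu\in\mathcal P(\mathbb R^d)$ with finite second moment, let $T_{\mu_0}^{\nu}$ be the ($\mu_0$-a.e. unique) map of minimal cost $\int\|T(x)-x\|^2\,d\mu_0(x)$ among all maps $T$ with $T\#\mu_0=\nu$; for $\nu$ without finite second moment the expression $\|T_{\mu_0}^{\nu}-T_{\mu_0}^{\mu_i}\|^2_{L^2(\mu_0)}$ is read as $\infty$. Define - $W_2\mathrm{BCM}(\{\mu_i\}_{i\in I})$ as the set of all measures that, for some Borel probability measure $\lambda$ on $I$, minimize $\nu\mapsto\int_I W_2^2(\nu,\mu_i)\,d\lambda(i)$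 over $\nu\in\mathcal P(\mathbb R^d)$ with finite minimal value; - $\mathrm{LBCM}(\mu_0;\{\mu_i\}_{i\in I})$ as the set of all measures that, for some Borel probability measure $\lambda$ on $I$, minimize $\nu\mapsto\int_I \|T_{\mu_0}^{\nu}-T_{\mu_0}^{\mu_i}\|^2_{L^2(\mu_0)}\,d\lambda(i)$ over $\nu\in\mathcal P(\mathbb R^d)$ with finite minimal value. Then $$W_2\mathrm{BCM}(\{\mu_i\}_{i\in I})\subset\mathcal G,\qquad \mathrm{LBCM}(\mu_0;\{\mu_i\}_{i\in I})\subset\mathcal G\quad\text{for every Gaussian base measure }\mu_0\in\mathcal G .$$ In contrast, the set of linear mixtures $$\Big\{\int_I \mu_{(x,\Sigma)}\,d\lambda(x,\Sigma)\ :\ \lambda\in\mathcal P(\mathbb R^d\times\mathbb S^d_{++})\Big\}$$ is dense in $\mathcal P(\mathbb R^d)$ with respect to weak convergence. -/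

import Mathlib

open MeasureTheory ProbabilityTheory
open scoped ENNReal

noncomputable section

/-! ## Optimal transport in the Euclidean space of dimension `d` -/

/-- The squared 2-Wasserstein distance between two measures: the infimum of the quadratic
transport cost over all couplings (with value `∞` if no coupling has finite cost). -/
def wassersteinSq {d : ℕ} (μ ν : Measure (EuclideanSpace ℝ (Fin d))) : ℝ≥0∞ :=
  ⨅ (π : Measure (EuclideanSpace ℝ (Fin d) × EuclideanSpace ℝ (Fin d)))
    (_ : π.map Prod.fst = μ ∧ π.map Prod.snd = ν), ∫⁻ p, ‖p.1 - p.2‖ₑ ^ 2 ∂π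

/-- The quadratic cost `∫ ‖T x - x‖² dμ(x)` of a transport map. -/
def transportCost {d : ℕ} (μ : Measure (EuclideanSpace ℝ (Fin d)))
    (T : EuclideanSpace ℝ (Fin d) → EuclideanSpace ℝ (Fin d)) : ℝ≥0∞ :=
  ∫⁻ x, ‖T x - x‖ₑ ^ 2 ∂μ

/-- `T` is an optimal transport map from `μ` to `ν` for the quadratic cost: it pushes `μ` forward
to `ν`, and it has minimal (finite) cost among all maps that do. -/
structure IsOptimalTransportMap {d : ℕ} (μ ν : Measure (EuclideanSpace ℝ (Fin d)))
    (T : EuclideanSpace ℝ (Fin d) → EuclideanSpace ℝ (Fin d)) : Prop where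
  measurable : Measurable T
  map_eq : μ.map T = ν
  cost_ne_top : transportCost μ T ≠ ∞
  cost_le : ∀ S : EuclideanSpace ℝ (Fin d) → EuclideanSpace ℝ (Fin d),
    Measurable S → μ.map S = ν → transportCost μ T ≤ transportCost μ S

open Classical in
/-- The optimal transport map `T_μ^ν`. For `μ` absolutely continuous with finite second moment it
exists if and only if `ν` has finite second moment, and is then unique up to `μ`-null sets; the
value `id` is a dummy for the case that there is no optimal map. -/
def optimalTransportMap {d : ℕ} (μ ν : Measure (EuclideanSpace ℝ (Fin d))) :
    EuclideanSpace ℝ (Fin d) → EuclideanSpace ℝ (Fin d) :=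
  if h : ∃ T, IsOptimalTransportMap μ ν T then h.choose else id

open Classical in
/-- The squared linear optimal transport discrepancy `‖T_{μ₀}^ν - T_{μ₀}^ρ‖²` in `L²(μ₀)`, with
value `∞` if one of the two optimal maps does not exist. -/
def linearOTSq {d : ℕ} (μ₀ ν ρ : Measure (EuclideanSpace ℝ (Fin d))) : ℝ≥0∞ :=
  if (∃ T, IsOptimalTransportMap μ₀ ν T) ∧ (∃ T, IsOptimalTransportMap μ₀ ρ T) then
    ∫⁻ x, ‖optimalTransportMap μ₀ ν x - optimalTransportMap μ₀ ρ x‖ₑ ^ 2 ∂μ₀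
  else ∞

/-! ## Barycentric coding models with an arbitrary family of references -/

/-- `ν` is a minimizer of `F` with finite value. (Where `F` is identically `∞`, the minimization
problem defines no measure.) -/
def IsFiniteMinimizer {α : Type*} (F : α → ℝ≥0∞) (ν : α) : Prop :=
  F ν ≠ ∞ ∧ ∀ ρ, F ν ≤ F ρ

/-- The 2-Wasserstein barycentric coding model of the family `μ`: all measures that minimize
`ν ↦ ∫ W₂²(ν, μ i) dw(i)` over all probability measures, for some weight `w`, a probability
measure on the index set. -/
def w2BCM {d : ℕ} {I : Type*} [MeasurableSpace I]
    (μ : I → ProbabilityMeasure (EuclideanSpace ℝ (Fin d))) :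
    Set (ProbabilityMeasure (EuclideanSpace ℝ (Fin d))) :=
  {η | ∃ w : ProbabilityMeasure I,
    IsFiniteMinimizer
      (fun ν : ProbabilityMeasure (EuclideanSpace ℝ (Fin d)) =>
        ∫⁻ i, wassersteinSq (ν : Measure (EuclideanSpace ℝ (Fin d)))
          (μ i : Measure (EuclideanSpace ℝ (Fin d))) ∂(w : Measure I)) η}

/-- The linear barycentric coding model with base `μ₀` of the family `μ`: all measures that
minimize `ν ↦ ∫ ‖T_{μ₀}^ν - T_{μ₀}^{μ i}‖² dw(i)` over all probability measures, for some weight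
`w`, a probability measure on the index set. -/
def lBCM {d : ℕ} {I : Type*} [MeasurableSpace I]
    (μ₀ : ProbabilityMeasure (EuclideanSpace ℝ (Fin d)))
    (μ : I → ProbabilityMeasure (EuclideanSpace ℝ (Fin d))) :
    Set (ProbabilityMeasure (EuclideanSpace ℝ (Fin d))) :=
  {η | ∃ w : ProbabilityMeasure I,
    IsFiniteMinimizer
      (fun ν : ProbabilityMeasure (EuclideanSpace ℝ (Fin d)) =>
        ∫⁻ i, linearOTSq (μ₀ : Measure (EuclideanSpace ℝ (Fin d)))
          (ν : Measure (EuclideanSpace ℝ (Fin d)))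
          (μ i : Measure (EuclideanSpace ℝ (Fin d))) ∂(w : Measure I)) η}

/-- The linear mixtures `∫ μ i dw(i)` of the family `μ`, where the weight `w` runs through the
probability measures on the index set. -/
def linearMixtures {d : ℕ} {I : Type*} [MeasurableSpace I]
    (μ : I → ProbabilityMeasure (EuclideanSpace ℝ (Fin d))) :
    Set (ProbabilityMeasure (EuclideanSpace ℝ (Fin d))) :=
  {η | ∃ w : ProbabilityMeasure I, ∀ s : Set (EuclideanSpace ℝ (Fin d)), MeasurableSet s →
    (η : Measure (EuclideanSpace ℝ (Fin d))) s =
      ∫⁻ i, (μ i : Measure (EuclideanSpace ℝ (Fin d))) s ∂(w : Measure I)}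

/-! ## The family of all nondegenerate Gaussians -/

/-- The set of symmetric positive definite real `d × d` matrices. -/
abbrev SPDMatrix (d : ℕ) : Type := {S : Matrix (Fin d) (Fin d) ℝ // S.PosDef}

/-- The Borel σ-algebra of the (entrywise) topology. -/
instance instMeasurableSpaceSPDMatrix (d : ℕ) : MeasurableSpace (SPDMatrix d) :=
  borel (SPDMatrix d)

instance instBorelSpaceSPDMatrix (d : ℕ) : BorelSpace (SPDMatrix d) := ⟨rfl⟩

/-- The Gaussian with mean `p.1` and covariance matrix `p.2`. -/
def gaussianFamily (d : ℕ) (p : EuclideanSpace ℝ (Fin d) × SPDMatrix d) :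
    ProbabilityMeasure (EuclideanSpace ℝ (Fin d)) :=
  ⟨multivariateGaussian p.1 p.2.1, inferInstance⟩

end

/-! ## Positive definite matrices acting on Euclidean space -/

open Matrix
open scoped RealInnerProductSpace

variable {d : ℕ}

local notation "𝔼" => EuclideanSpace ℝ (Fin d)
local notation "𝐋" => toEuclideanCLM (𝕜 := ℝ) (n := Fin d)

/-! Everything about transport rests on one completion of the square, `norm_sub_sq_eq_of_posDef`.
For positive definite `A`, the cost of any coupling of two measures with finite second moments is an
expression in their means and covariances plus a deficit `∫ ⟪e, A e⟫ ≥ 0`, where `e = p - (m + A⁻¹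
(q - x))`. If `A P A = S`, the affine coupling of `N(m, P)` and `N(x, S)` has deficit zero.

Wasserstein barycenters: let `η` be a minimizer with mean `m` and covariance `K`. If `K` is
nonsingular, replacing `η` by `N(m, K)` lowers the distance to each reference by at least a multiple
of `W₂²(η, N(m, K))`, because `m + A⁻¹ (q - x)` has law `N(m, K)`. Minimality forces this distance
to vanish. To exclude singular `K`, compare with `N(m, K + t 1)`: the loss is at most `t d`, but the
gain `t tr A` is of order `√t`, which wins for small `t`. Both comparisons are
`wassersteinSq_multivariateGaussian_add_le`, integrated in `lintegral_le_of_isFiniteMinimizer`.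

Linear barycenters: optimal maps from a nondegenerate Gaussian to the references are affine with
positive definite linear part, and a.e. unique. In `L²(μ₀)` the objective is a mean squared
distance, so the bias-variance identity makes the averaged map the only minimizer; it is again
affine with positive definite linear part, so its image is Gaussian.

Density: `η` convolved with `N(0, r² 1)` is a mixture and tends weakly to `η` as `r → 0`. -/

theorem Matrix.PosDef.inner_toEuclideanCLM_pos {A : Matrix (Fin d) (Fin d) ℝ} (hA : A.PosDef)
    {v : 𝔼} (hv : v ≠ 0) : 0 < ⟪v, 𝐋 A v⟫ := by
  rw [inner_toEuclideanCLM]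
  simpa using hA.dotProduct_mulVec_pos (x := v.ofLp) (by simpa using hv)

theorem Matrix.PosSemidef.inner_toEuclideanCLM_nonneg {A : Matrix (Fin d) (Fin d) ℝ}
    (hA : A.PosSemidef) (v : 𝔼) : 0 ≤ ⟪v, 𝐋 A v⟫ := by
  rw [inner_toEuclideanCLM]
  simpa using hA.dotProduct_mulVec_nonneg v.ofLp

theorem Matrix.IsHermitian.inner_toEuclideanCLM_comm {A : Matrix (Fin d) (Fin d) ℝ}
    (hA : A.IsHermitian) (v w : 𝔼) : ⟪v, 𝐋 A w⟫ = ⟪𝐋 A v, w⟫ := by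
  rw [real_inner_comm w, inner_toEuclideanCLM, inner_toEuclideanCLM, dotProduct_comm,
    ← vecMul_transpose, show Aᵀ = A by simpa using hA.eq, dotProduct_mulVec, dotProduct_comm,
    dotProduct_comm]

theorem posDef_of_inner_toEuclideanCLM_pos {A : Matrix (Fin d) (Fin d) ℝ} (hA : A.IsHermitian)
    (h : ∀ v : 𝔼, v ≠ 0 → 0 < ⟪v, 𝐋 A v⟫) : A.PosDef := by
  refine PosDef.of_dotProduct_mulVec_pos hA fun x hx => ?_
  have := h (WithLp.toLp 2 x) (by simpa using hx)
  rw [inner_toEuclideanCLM] at this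
  simpa using this

theorem toEuclideanCLM_mul_apply (A B : Matrix (Fin d) (Fin d) ℝ) (v : 𝔼) :
    𝐋 (A * B) v = 𝐋 A (𝐋 B v) := by
  rw [map_mul]; rfl

theorem toEuclideanCLM_inv_apply {A : Matrix (Fin d) (Fin d) ℝ} (hA : A.PosDef) (v : 𝔼) :
    𝐋 A (𝐋 A⁻¹ v) = v := by
  rw [← toEuclideanCLM_mul_apply, mul_nonsing_inv _ ((isUnit_iff_isUnit_det _).1 hA.isUnit)]
  simp

theorem toEuclideanCLM_apply_inv {A : Matrix (Fin d) (Fin d) ℝ} (hA : A.PosDef) (v : 𝔼) :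
    𝐋 A⁻¹ (𝐋 A v) = v := by
  rw [← toEuclideanCLM_mul_apply, nonsing_inv_mul _ ((isUnit_iff_isUnit_det _).1 hA.isUnit)]
  simp

/-! ### Square roots and the equation `A * P * A = S`. -/

section Sqrt

open scoped MatrixOrder

theorem Matrix.PosDef.exists_posDef_mul_self {P : Matrix (Fin d) (Fin d) ℝ} (hP : P.PosDef) :
    ∃ R : Matrix (Fin d) (Fin d) ℝ, R.PosDef ∧ R * R = P :=
  ⟨CFC.sqrt P, isStrictlyPositive_iff_posDef.1
    (IsStrictlyPositive.sqrt P (isStrictlyPositive_iff_posDef.2 hP)),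
    CFC.sqrt_mul_sqrt_self P hP.posSemidef.nonneg⟩

theorem Matrix.PosSemidef.exists_posSemidef_mul_self {P : Matrix (Fin d) (Fin d) ℝ}
    (hP : P.PosSemidef) : ∃ R : Matrix (Fin d) (Fin d) ℝ, R.PosSemidef ∧ R * R = P :=
  ⟨CFC.sqrt P, nonneg_iff_posSemidef.1 (CFC.sqrt_nonneg P),
    CFC.sqrt_mul_sqrt_self P hP.nonneg⟩

theorem Matrix.PosDef.eq_of_mul_self_eq {A B : Matrix (Fin d) (Fin d) ℝ} (hA : A.PosDef)
    (hB : B.PosDef) (h : A * A = B * B) : A = B :=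
  (CFC.sqrt_unique h hA.posSemidef.nonneg).symm.trans
    (CFC.sqrt_unique rfl hB.posSemidef.nonneg)

end Sqrt

theorem Matrix.PosDef.mul_mul_self {A B : Matrix (Fin d) (Fin d) ℝ} (hA : A.PosDef)
    (hB : B.PosDef) : (A * B * A).PosDef := by
  have h := hB.conjTranspose_mul_mul_same (B := A)
    (mulVec_injective_of_isUnit hA.isUnit)
  rwa [hA.isHermitian.eq] at h

/-- The linear part of the optimal transport map between centered Gaussians. -/
theorem exists_posDef_mul_mul_eq {P S : Matrix (Fin d) (Fin d) ℝ} (hP : P.PosDef)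
    (hS : S.PosDef) : ∃ A : Matrix (Fin d) (Fin d) ℝ, A.PosDef ∧ A * P * A = S := by
  obtain ⟨R, hR, hRP⟩ := hP.exists_posDef_mul_self
  obtain ⟨Q, hQ, hQS⟩ := (hR.mul_mul_self hS).exists_posDef_mul_self
  have hu : IsUnit R.det := (isUnit_iff_isUnit_det _).1 hR.isUnit
  -- The classical formula `A = P^(-1/2) (P^(1/2) S P^(1/2))^(1/2) P^(-1/2)`.
  refine ⟨R⁻¹ * Q * R⁻¹, hR.inv.mul_mul_self hQ, ?_⟩
  calc R⁻¹ * Q * R⁻¹ * P * (R⁻¹ * Q * R⁻¹)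
      = R⁻¹ * Q * (R⁻¹ * R) * (R * R⁻¹) * Q * R⁻¹ := by rw [← hRP]; simp only [Matrix.mul_assoc]
    _ = R⁻¹ * (Q * Q) * R⁻¹ := by
        rw [nonsing_inv_mul _ hu, mul_nonsing_inv _ hu]; simp only [Matrix.mul_assoc, mul_one]
    _ = (R⁻¹ * R) * S * (R * R⁻¹) := by rw [hQS]; simp only [Matrix.mul_assoc]
    _ = S := by rw [nonsing_inv_mul _ hu, mul_nonsing_inv _ hu, one_mul, mul_one]

/-- With `R = √P`, the matrix `R A R` is a positive definite root of `R (A P A) R`, and such roots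
are unique. -/
theorem eq_of_posDef_mul_mul_eq {P A B : Matrix (Fin d) (Fin d) ℝ} (hP : P.PosDef)
    (hA : A.PosDef) (hB : B.PosDef) (h : A * P * A = B * P * B) : A = B := by
  obtain ⟨R, hR, hRP⟩ := hP.exists_posDef_mul_self
  have hu : IsUnit R.det := (isUnit_iff_isUnit_det _).1 hR.isUnit
  have key : R * A * R = R * B * R := by
    refine (hR.mul_mul_self hA).eq_of_mul_self_eq (hR.mul_mul_self hB) ?_
    calc R * A * R * (R * A * R) = R * (A * P * A) * R := by
          rw [← hRP]; simp only [Matrix.mul_assoc]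
      _ = R * B * R * (R * B * R) := by rw [h, ← hRP]; simp only [Matrix.mul_assoc]
  have := congrArg (fun M => R⁻¹ * M * R⁻¹) key
  simpa [Matrix.mul_assoc, nonsing_inv_mul_cancel_left _ _ hu, mul_nonsing_inv _ hu] using this

/-! ### Trace and eigenvalue bounds. -/

theorem norm_toEuclideanCLM_sq_le (B : Matrix (Fin d) (Fin d) ℝ) (v : 𝔼) :
    ‖𝐋 B v‖ ^ 2 ≤ (B * Bᵀ).trace * ‖v‖ ^ 2 := by
  rw [EuclideanSpace.real_norm_sq_eq, EuclideanSpace.real_norm_sq_eq, trace, Finset.sum_mul]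
  refine Finset.sum_le_sum fun i _ => ?_
  simp only [diag_apply, mul_apply, transpose_apply, ofLp_toEuclideanCLM, mulVec, dotProduct]
  simpa [sq] using Finset.sum_mul_sq_le_sq_mul_sq Finset.univ (B i) v.ofLp

theorem Matrix.PosSemidef.inner_toEuclideanCLM_le_trace {A : Matrix (Fin d) (Fin d) ℝ}
    (hA : A.PosSemidef) (v : 𝔼) : ⟪v, 𝐋 A v⟫ ≤ A.trace * ‖v‖ ^ 2 := by
  obtain ⟨R, hR, rfl⟩ := hA.exists_posSemidef_mul_self
  have h := norm_toEuclideanCLM_sq_le R v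
  rw [show Rᵀ = R by simpa using hR.isHermitian.eq] at h
  rwa [toEuclideanCLM_mul_apply, hR.isHermitian.inner_toEuclideanCLM_comm,
    real_inner_self_eq_norm_sq]

theorem Matrix.PosSemidef.norm_toEuclideanCLM_le_trace {A : Matrix (Fin d) (Fin d) ℝ}
    (hA : A.PosSemidef) (v : 𝔼) : ‖𝐋 A v‖ ≤ A.trace * ‖v‖ := by
  refine le_of_sq_le_sq ?_ (mul_nonneg hA.trace_nonneg (norm_nonneg _))
  obtain ⟨R, hR, rfl⟩ := hA.exists_posSemidef_mul_self
  have h := norm_toEuclideanCLM_sq_le R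
  rw [show Rᵀ = R by simpa using hR.isHermitian.eq] at h
  rw [toEuclideanCLM_mul_apply]
  calc _ ≤ _ := h _
    _ ≤ (R * R).trace * ((R * R).trace * ‖v‖ ^ 2) :=
      mul_le_mul_of_nonneg_left (h v) hA.trace_nonneg
    _ = _ := by ring

/-- Cauchy–Schwarz for `√A v` and `(√A)⁻¹ w`. -/
theorem Matrix.PosDef.inner_sq_le {A : Matrix (Fin d) (Fin d) ℝ} (hA : A.PosDef) (v w : 𝔼) :
    ⟪v, w⟫ ^ 2 ≤ ⟪v, 𝐋 A v⟫ * ⟪w, 𝐋 A⁻¹ w⟫ := by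
  obtain ⟨R, hR, rfl⟩ := hA.exists_posDef_mul_self
  rw [Matrix.mul_inv_rev, toEuclideanCLM_mul_apply, toEuclideanCLM_mul_apply,
    hR.isHermitian.inner_toEuclideanCLM_comm, hR.inv.isHermitian.inner_toEuclideanCLM_comm,
    real_inner_self_eq_norm_sq, real_inner_self_eq_norm_sq]
  have h : ⟪v, w⟫ = ⟪𝐋 R v, 𝐋 R⁻¹ w⟫ := by
    rw [← hR.isHermitian.inner_toEuclideanCLM_comm, toEuclideanCLM_inv_apply hR]
  rw [h, ← mul_pow]
  exact sq_le_sq.2 (by simpa [abs_mul] using abs_real_inner_le_norm (𝐋 R v) (𝐋 R⁻¹ w))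

theorem Matrix.PosDef.exists_lower_bound {A : Matrix (Fin d) (Fin d) ℝ} (hA : A.PosDef) :
    ∃ σ > 0, ∀ v : 𝔼, σ * ‖v‖ ^ 2 ≤ ⟪v, 𝐋 A v⟫ := by
  -- The summand `1` keeps the constant positive in dimension `0`, where the trace vanishes.
  have h0 : 0 < A⁻¹.trace + 1 := by linarith [hA.inv.posSemidef.trace_nonneg]
  refine ⟨(A⁻¹.trace + 1)⁻¹, inv_pos.2 h0, fun v => ?_⟩
  rcases eq_or_ne v 0 with rfl | hv
  · simp
  have h1 := hA.inner_sq_le v v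
  have h2 := hA.inv.posSemidef.inner_toEuclideanCLM_le_trace v
  have h3 := hA.posSemidef.inner_toEuclideanCLM_nonneg v
  have hv' : 0 < ‖v‖ ^ 2 := by positivity
  rw [real_inner_self_eq_norm_sq] at h1
  rw [inv_mul_le_iff₀ h0]
  refine le_of_mul_le_mul_right ?_ hv'
  nlinarith [mul_le_mul_of_nonneg_left h2 h3, mul_nonneg h3 hv'.le]

variable {A P S : Matrix (Fin d) (Fin d) ℝ}

theorem mul_norm_inv_sq_le (hA : A.PosDef) (h : A * P * A = S) {σ : ℝ}
    (hσ : ∀ v : 𝔼, σ * ‖v‖ ^ 2 ≤ ⟪v, 𝐋 S v⟫) (v : 𝔼) :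
    σ * ‖𝐋 A⁻¹ v‖ ^ 2 ≤ ⟪v, 𝐋 P v⟫ := by
  refine (hσ _).trans_eq ?_
  rw [← h, toEuclideanCLM_mul_apply, toEuclideanCLM_mul_apply,
    hA.isHermitian.inner_toEuclideanCLM_comm, toEuclideanCLM_inv_apply hA]

/-- If `P` has a small eigenvalue, then every `A` with `A P A = S` has a large trace. -/
theorem mul_norm_sq_le_of_mul_mul_eq (hA : A.PosDef) (h : A * P * A = S) {σ t : ℝ}
    (hσ0 : 0 ≤ σ) (hσ : ∀ v : 𝔼, σ * ‖v‖ ^ 2 ≤ ⟪v, 𝐋 S v⟫) {v : 𝔼} (hv : v ≠ 0)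
    (hvt : ⟪v, 𝐋 P v⟫ = t * ‖v‖ ^ 2) : σ ≤ t * A.trace ^ 2 := by
  have h1 := mul_norm_inv_sq_le hA h hσ v
  have h2 := hA.posSemidef.norm_toEuclideanCLM_le_trace (𝐋 A⁻¹ v)
  rw [toEuclideanCLM_inv_apply hA] at h2
  have hv' : 0 < ‖v‖ ^ 2 := by positivity
  refine le_of_mul_le_mul_right ?_ hv'
  calc σ * ‖v‖ ^ 2 ≤ σ * (A.trace * ‖𝐋 A⁻¹ v‖) ^ 2 := by gcongr
    _ = A.trace ^ 2 * (σ * ‖𝐋 A⁻¹ v‖ ^ 2) := by ring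
    _ ≤ A.trace ^ 2 * (t * ‖v‖ ^ 2) := by rw [← hvt]; gcongr
    _ = _ := by ring

/-- A lower bound for `A` with `A P A = S` that depends on `P` and on the least eigenvalue of `S`
only. -/
theorem exists_uniform_lower_bound (hP : P.PosDef) {σ : ℝ} (hσ0 : 0 < σ) :
    ∃ c > 0, ∀ A S : Matrix (Fin d) (Fin d) ℝ, A.PosDef → A * P * A = S →
      (∀ v : 𝔼, σ * ‖v‖ ^ 2 ≤ ⟪v, 𝐋 S v⟫) → ∀ v : 𝔼, c * ‖v‖ ^ 2 ≤ ⟪v, 𝐋 A v⟫ := by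
  -- `κ` bounds the norm of `A⁻¹`: that norm squared is at most `tr P / σ`, and the added `1` gives
  -- `tr P / σ ≤ κ ≤ κ²`, avoiding a root.
  set κ : ℝ := P.trace / σ + 1 with hκ
  have hκ1 : 1 ≤ κ := by
    have := hP.posSemidef.trace_nonneg
    have : 0 ≤ P.trace / σ := by positivity
    linarith
  have hκ0 : 0 < κ := by linarith
  refine ⟨κ⁻¹, inv_pos.2 hκ0, fun A S hA h hσ v => ?_⟩
  rcases eq_or_ne v 0 with rfl | hv
  · simp
  have hv' : 0 < ‖v‖ ^ 2 := by positivity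
  have h1 := (mul_norm_inv_sq_le hA h hσ v).trans (hP.posSemidef.inner_toEuclideanCLM_le_trace v)
  have h2 : ‖𝐋 A⁻¹ v‖ ^ 2 ≤ (κ * ‖v‖) ^ 2 := by
    have : ‖𝐋 A⁻¹ v‖ ^ 2 ≤ P.trace / σ * ‖v‖ ^ 2 := by
      rw [div_mul_eq_mul_div, le_div_iff₀ hσ0]; linarith
    rw [mul_pow]
    nlinarith
  have h3 : ‖𝐋 A⁻¹ v‖ ≤ κ * ‖v‖ := le_of_sq_le_sq h2 (by positivity)
  have h4 : ⟪v, 𝐋 A⁻¹ v⟫ ≤ κ * ‖v‖ ^ 2 := by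
    calc _ ≤ ‖v‖ * ‖𝐋 A⁻¹ v‖ := real_inner_le_norm _ _
      _ ≤ ‖v‖ * (κ * ‖v‖) := by gcongr
      _ = _ := by ring
  have h5 := hA.inner_sq_le v v
  rw [real_inner_self_eq_norm_sq] at h5
  have h6 := hA.posSemidef.inner_toEuclideanCLM_nonneg v
  rw [inv_mul_le_iff₀ hκ0]
  refine le_of_mul_le_mul_right ?_ hv'
  nlinarith [mul_le_mul_of_nonneg_left h4 h6]

theorem MeasureTheory.MemLp.integrable_inner_of_two {α : Type*} {mα : MeasurableSpace α}
    {μ : Measure α} {f g : α → 𝔼} (hf : MemLp f 2 μ) (hg : MemLp g 2 μ) :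
    Integrable (fun x => ⟪f x, g x⟫) μ :=
  (hf.norm.integrable_mul hg.norm).mono
    (hf.aestronglyMeasurable.inner hg.aestronglyMeasurable) (.of_forall fun x => by
      simpa using abs_real_inner_le_norm (f x) (g x))

/-! ## Measures with given mean and covariance -/

/-- `ρ` is a probability measure with finite second moment, mean `m` and covariance matrix `K`. -/
structure HasMeanCov (ρ : Measure 𝔼) (m : 𝔼) (K : Matrix (Fin d) (Fin d) ℝ) : Prop where
  isProbabilityMeasure : IsProbabilityMeasure ρ
  memLp : MemLp id 2 ρ
  mean : ∫ x, x ∂ρ = m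
  cov : ∀ i j, ∫ x, (x i - m i) * (x j - m j) ∂ρ = K i j

namespace HasMeanCov

variable {ρ : Measure (EuclideanSpace ℝ (Fin d))} {m : EuclideanSpace ℝ (Fin d)}
  {K : Matrix (Fin d) (Fin d) ℝ}

theorem memLp_sub (h : HasMeanCov ρ m K) : MemLp (fun x : 𝔼 => x - m) 2 ρ := by
  have := h.isProbabilityMeasure
  exact h.memLp.sub (memLp_const m)

theorem integral_inner (h : HasMeanCov ρ m K) (v : 𝔼) : ∫ x, ⟪x - m, v⟫ ∂ρ = 0 := by
  have := h.isProbabilityMeasure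
  have h1 : Integrable (fun x : 𝔼 => x - m) ρ := h.memLp_sub.integrable one_le_two
  have h2 : Integrable (fun x : 𝔼 => x) ρ := h.memLp.integrable one_le_two
  simp_rw [real_inner_comm v]
  rw [_root_.integral_inner h1, integral_sub h2 (integrable_const _), h.mean]
  simp

theorem integrable_quadratic (h : HasMeanCov ρ m K) (A : Matrix (Fin d) (Fin d) ℝ) :
    Integrable (fun x => ⟪x - m, 𝐋 A (x - m)⟫) ρ :=
  h.memLp_sub.integrable_inner_of_two ((𝐋 A).comp_memLp' h.memLp_sub)

theorem integral_quadratic (h : HasMeanCov ρ m K) (A : Matrix (Fin d) (Fin d) ℝ) :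
    ∫ x, ⟪x - m, 𝐋 A (x - m)⟫ ∂ρ = (A * K).trace := by
  have hc : ∀ i, MemLp (fun x : 𝔼 => x i - m i) 2 ρ := fun i =>
    (EuclideanSpace.proj (𝕜 := ℝ) i).comp_memLp' h.memLp_sub
  have hi : ∀ i j, Integrable (fun x : 𝔼 => (x i - m i) * (x j - m j)) ρ := fun i j =>
    (hc i).integrable_mul (hc j)
  have he : ∀ x : 𝔼, ⟪x - m, 𝐋 A (x - m)⟫
      = ∑ i, ∑ j, A i j * ((x j - m j) * (x i - m i)) := fun x => by
    rw [inner_toEuclideanCLM]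
    simp only [dotProduct, mulVec, Finset.mul_sum, PiLp.sub_apply]
    exact Finset.sum_congr rfl fun i _ => Finset.sum_congr rfl fun j _ => by ring
  simp_rw [he]
  refine (integral_finsetSum _ fun i _ =>
    integrable_finsetSum _ fun j _ => (hi j i).const_mul _).trans ?_
  simp only [trace, diag_apply, mul_apply]
  refine Finset.sum_congr rfl fun i _ => ?_
  refine (integral_finsetSum _ fun j _ => (hi j i).const_mul _).trans ?_
  exact Finset.sum_congr rfl fun j _ => by rw [integral_const_mul, h.cov]

theorem posSemidef (h : HasMeanCov ρ m K) : K.PosSemidef := by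
  have hK : K.IsHermitian := by
    ext i j
    simp only [conjTranspose_apply, star_trivial, ← h.cov]
    exact integral_congr_ae (.of_forall fun x => mul_comm _ _)
  refine PosSemidef.of_dotProduct_mulVec_nonneg hK fun v => ?_
  -- The rank-one matrix `v vᵀ` turns the quadratic form into the square of `⟪x - m, v⟫`.
  have h1 := h.integral_quadratic (vecMulVec v v)
  rw [vecMulVec_mul, trace_vecMulVec, dotProduct_comm, ← dotProduct_mulVec] at h1
  rw [star_trivial, ← h1]
  refine integral_nonneg fun x => ?_
  rw [Pi.zero_apply, inner_toEuclideanCLM, vecMulVec_mulVec]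
  rw [dotProduct_smul, dotProduct_comm v, op_smul_eq_mul]
  exact mul_self_nonneg _

end HasMeanCov

theorem exists_hasMeanCov {ρ : Measure 𝔼} [IsProbabilityMeasure ρ] (h : MemLp id 2 ρ) :
    ∃ m K, HasMeanCov ρ m K :=
  ⟨_, fun _ _ => _, inferInstance, h, rfl, fun _ _ => rfl⟩

theorem hasMeanCov_multivariateGaussian (m : 𝔼) {K : Matrix (Fin d) (Fin d) ℝ}
    (hK : K.PosSemidef) : HasMeanCov (multivariateGaussian m K) m K where
  isProbabilityMeasure := inferInstance
  memLp := IsGaussian.memLp_two_id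
  mean := integral_id_multivariateGaussian
  cov i j := by
    have hi : ∀ i : Fin d, ∫ x : 𝔼, x i ∂(multivariateGaussian m K) = m i := fun i => by
      have := (EuclideanSpace.proj (𝕜 := ℝ) i).integral_comp_comm
        (IsGaussian.integrable_fun_id (μ := multivariateGaussian m K))
      simpa using this
    rw [← covariance_eval_multivariateGaussian (μ := m) hK i j, covariance, hi, hi]

/-- Affine images of Gaussians are Gaussian. -/
theorem map_affine_multivariateGaussian (m x : 𝔼) {A K : Matrix (Fin d) (Fin d) ℝ}
    (hK : K.PosSemidef) (hA : A.IsHermitian) :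
    (multivariateGaussian m K).map (fun z => x + 𝐋 A (z - m))
      = multivariateGaussian x (A * K * A) := by
  have hS : (A * K * A).PosSemidef := by
    have := hK.conjTranspose_mul_mul_same A
    rwa [hA.eq] at this
  have hm : Measurable fun z : 𝔼 => x + 𝐋 A (z - m) := by fun_prop
  have : IsProbabilityMeasure ((multivariateGaussian m K).map (fun z => x + 𝐋 A (z - m))) :=
    Measure.isProbabilityMeasure_map hm.aemeasurable
  refine Measure.ext_of_charFun (funext fun t => ?_)
  rw [charFun_multivariateGaussian hS, charFun_apply, integral_map hm.aemeasurable
    (by fun_prop)]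
  have he : ∀ z : 𝔼, Complex.exp (⟪x + 𝐋 A (z - m), t⟫ * Complex.I)
      = Complex.exp (⟪x - 𝐋 A m, t⟫ * Complex.I) * Complex.exp (⟪z, 𝐋 A t⟫ * Complex.I) := by
    intro z
    rw [← Complex.exp_add, ← add_mul, hA.inner_toEuclideanCLM_comm, ← Complex.ofReal_add,
      ← inner_add_left, map_sub]
    congr 4
    abel
  simp_rw [he]
  rw [integral_const_mul, ← charFun_apply, charFun_multivariateGaussian hK, ← Complex.exp_add]
  congr 1
  have h1 : (𝐋 A t).ofLp ⬝ᵥ K *ᵥ (𝐋 A t).ofLp = t.ofLp ⬝ᵥ (A * K * A) *ᵥ t.ofLp := by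
    rw [← inner_toEuclideanCLM, ← inner_toEuclideanCLM, toEuclideanCLM_mul_apply,
      toEuclideanCLM_mul_apply, hA.inner_toEuclideanCLM_comm]
  have h2 : ⟪𝐋 A t, m⟫ = ⟪t, 𝐋 A m⟫ := (hA.inner_toEuclideanCLM_comm _ _).symm
  rw [h1, h2, inner_sub_left, real_inner_comm t x, real_inner_comm t (𝐋 A m)]
  push_cast
  ring

/-! ## The cost of a coupling -/

/-- The cross term `-2 ⟪p - m, q - x⟫` is absorbed into a square in the inner product given by `A`.
What remains depends on `p` alone or on `q` alone, hence integrates to the same value for every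
coupling. -/
theorem norm_sub_sq_eq_of_posDef {A : Matrix (Fin d) (Fin d) ℝ} (hA : A.PosDef) (m x p q : 𝔼) :
    ‖p - q‖ ^ 2 = (⟪p - m, 𝐋 (1 - A) (p - m)⟫ + 2 * ⟪p - m, m - x⟫)
      + (⟪q - x, 𝐋 (1 - A⁻¹) (q - x)⟫ - 2 * ⟪q - x, m - x⟫)
      + ‖m - x‖ ^ 2 + ⟪p - (m + 𝐋 A⁻¹ (q - x)), 𝐋 A (p - (m + 𝐋 A⁻¹ (q - x)))⟫ := by
  have e1 : p - (m + 𝐋 A⁻¹ (q - x)) = (p - m) - 𝐋 A⁻¹ (q - x) := by abel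
  have e2 : p - q = (p - m) - (q - x) + (m - x) := by abel
  rw [e1, e2]
  generalize p - m = u
  generalize q - x = y
  generalize m - x = z
  rw [map_sub, map_sub, map_sub, toEuclideanCLM_inv_apply hA, map_one,
    ← real_inner_self_eq_norm_sq, ← real_inner_self_eq_norm_sq]
  have h1 : ⟪𝐋 A⁻¹ y, 𝐋 A u⟫ = ⟪y, u⟫ := by
    rw [← hA.inv.isHermitian.inner_toEuclideanCLM_comm, toEuclideanCLM_apply_inv hA]
  simp only [_root_.sub_apply, one_apply_eq_self, inner_add_left,
    inner_add_right, inner_sub_left, inner_sub_right, h1, real_inner_comm u y,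
    real_inner_comm z u, real_inner_comm z y, real_inner_comm y (𝐋 A⁻¹ y)]
  ring

section Coupling

variable {η ρ : Measure (EuclideanSpace ℝ (Fin d))} {m x : EuclideanSpace ℝ (Fin d)}
  {K S A : Matrix (Fin d) (Fin d) ℝ}
  {π : Measure (EuclideanSpace ℝ (Fin d) × EuclideanSpace ℝ (Fin d))}

theorem integral_norm_sub_sq_of_coupling (hη : HasMeanCov η m K) (hρ : HasMeanCov ρ x S)
    (hA : A.PosDef) (h1 : π.map Prod.fst = η) (h2 : π.map Prod.snd = ρ) :
    Integrable (fun p : 𝔼 × 𝔼 => ‖p.1 - p.2‖ ^ 2) π ∧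
    Integrable (fun p : 𝔼 × 𝔼 =>
      ⟪p.1 - (m + 𝐋 A⁻¹ (p.2 - x)), 𝐋 A (p.1 - (m + 𝐋 A⁻¹ (p.2 - x)))⟫) π ∧
    ∫ p, ‖p.1 - p.2‖ ^ 2 ∂π = ((1 - A) * K).trace + ((1 - A⁻¹) * S).trace + ‖m - x‖ ^ 2
      + ∫ p, ⟪p.1 - (m + 𝐋 A⁻¹ (p.2 - x)), 𝐋 A (p.1 - (m + 𝐋 A⁻¹ (p.2 - x)))⟫ ∂π := by
  have hπ : IsProbabilityMeasure π := by
    constructor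
    have h := hη.isProbabilityMeasure.measure_univ
    rwa [← h1, Measure.map_apply measurable_fst .univ] at h
  have := hη.isProbabilityMeasure
  have := hρ.isProbabilityMeasure
  have mp1 : MeasurePreserving Prod.fst π η := ⟨measurable_fst, h1⟩
  have mp2 : MeasurePreserving Prod.snd π ρ := ⟨measurable_snd, h2⟩
  have l1 : MemLp (fun p : 𝔼 × 𝔼 => p.1 - m) 2 π := hη.memLp_sub.comp_measurePreserving mp1
  have l2 : MemLp (fun p : 𝔼 × 𝔼 => p.2 - x) 2 π := hρ.memLp_sub.comp_measurePreserving mp2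
  have l3 : MemLp (fun p : 𝔼 × 𝔼 => p.1 - (m + 𝐋 A⁻¹ (p.2 - x))) 2 π := by
    have := l1.sub ((𝐋 A⁻¹).comp_memLp' l2)
    refine this.congr_norm (by fun_prop) (.of_forall fun p => ?_)
    simp only [Pi.sub_apply, Function.comp_apply, sub_sub]
  have i3 : Integrable (fun p : 𝔼 × 𝔼 =>
      ⟪p.1 - (m + 𝐋 A⁻¹ (p.2 - x)), 𝐋 A (p.1 - (m + 𝐋 A⁻¹ (p.2 - x)))⟫) π :=
    l3.integrable_inner_of_two ((𝐋 A).comp_memLp' l3)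
  have g1 : Integrable (fun z : 𝔼 => ⟪z - m, 𝐋 (1 - A) (z - m)⟫ + 2 * ⟪z - m, m - x⟫) η :=
    (hη.integrable_quadratic _).add
      (((hη.memLp_sub.integrable one_le_two).inner_const _).const_mul _)
  have g2 : Integrable (fun z : 𝔼 => ⟪z - x, 𝐋 (1 - A⁻¹) (z - x)⟫ - 2 * ⟪z - x, m - x⟫) ρ :=
    (hρ.integrable_quadratic _).sub
      (((hρ.memLp_sub.integrable one_le_two).inner_const _).const_mul _)
  have v1 : ∫ z, (⟪z - m, 𝐋 (1 - A) (z - m)⟫ + 2 * ⟪z - m, m - x⟫) ∂η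
      = ((1 - A) * K).trace := by
    rw [integral_add (hη.integrable_quadratic _)
      (((hη.memLp_sub.integrable one_le_two).inner_const _).const_mul _), integral_const_mul,
      hη.integral_inner, hη.integral_quadratic, mul_zero, add_zero]
  have v2 : ∫ z, (⟪z - x, 𝐋 (1 - A⁻¹) (z - x)⟫ - 2 * ⟪z - x, m - x⟫) ∂ρ
      = ((1 - A⁻¹) * S).trace := by
    rw [integral_sub (hρ.integrable_quadratic _)
      (((hρ.memLp_sub.integrable one_le_two).inner_const _).const_mul _), integral_const_mul,
      hρ.integral_inner, hρ.integral_quadratic, mul_zero, sub_zero]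
  have j1 := mp1.integrable_comp_of_integrable g1
  have j2 := mp2.integrable_comp_of_integrable g2
  rw [← h1, integral_map measurable_fst.aemeasurable (by fun_prop)] at v1
  rw [← h2, integral_map measurable_snd.aemeasurable (by fun_prop)] at v2
  have key := fun p : 𝔼 × 𝔼 => norm_sub_sq_eq_of_posDef hA m x p.1 p.2
  simp_rw [key]
  have j12 := j1.add j2
  have j12c := j12.add (integrable_const (‖m - x‖ ^ 2))
  refine ⟨j12c.add i3, i3, ?_⟩
  rw [← v1, ← v2]
  refine (integral_add j12c i3).trans ?_
  congr 1
  refine (integral_add j12 (integrable_const _)).trans ?_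
  rw [integral_const, probReal_univ, one_smul]
  congr 1
  exact integral_add j1 j2

theorem lintegral_enorm_sub_sq_of_coupling (hη : HasMeanCov η m K) (hρ : HasMeanCov ρ x S)
    (hA : A.PosDef) (h1 : π.map Prod.fst = η) (h2 : π.map Prod.snd = ρ) :
    ∫⁻ p, ‖p.1 - p.2‖ₑ ^ 2 ∂π = ENNReal.ofReal
      (((1 - A) * K).trace + ((1 - A⁻¹) * S).trace + ‖m - x‖ ^ 2
      + ∫ p, ⟪p.1 - (m + 𝐋 A⁻¹ (p.2 - x)), 𝐋 A (p.1 - (m + 𝐋 A⁻¹ (p.2 - x)))⟫ ∂π) := by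
  obtain ⟨i1, -, h⟩ := integral_norm_sub_sq_of_coupling hη hρ hA h1 h2
  rw [← h, ofReal_integral_eq_lintegral_ofReal i1 (.of_forall fun p => by positivity)]
  simp only [ENNReal.ofReal_pow (norm_nonneg _), ofReal_norm]

end Coupling

/-! ## Wasserstein distances to Gaussians -/

theorem wassersteinSq_le {μ ν : Measure 𝔼} {π : Measure (𝔼 × 𝔼)} (h1 : π.map Prod.fst = μ)
    (h2 : π.map Prod.snd = ν) : wassersteinSq μ ν ≤ ∫⁻ p, ‖p.1 - p.2‖ₑ ^ 2 ∂π :=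
  iInf₂_le π ⟨h1, h2⟩

theorem wassersteinSq_map_le {α : Type*} [MeasurableSpace α] {ρ : Measure α} {f g : α → 𝔼}
    (hf : Measurable f) (hg : Measurable g) :
    wassersteinSq (ρ.map f) (ρ.map g) ≤ ∫⁻ a, ‖f a - g a‖ₑ ^ 2 ∂ρ := by
  refine (wassersteinSq_le (π := ρ.map fun a => (f a, g a)) ?_ ?_).trans_eq ?_
  · rw [Measure.map_map measurable_fst (hf.prodMk hg)]; rfl
  · rw [Measure.map_map measurable_snd (hf.prodMk hg)]; rfl
  · rw [lintegral_map (by fun_prop) (hf.prodMk hg)]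

/-- Since `|exp (i a) - exp (i b)| ≤ |a - b|`, the transport cost controls characteristic functions.
This shows that vanishing distance implies equality without needing an optimal coupling. -/
theorem enorm_charFun_sub_sq_le {π : Measure (𝔼 × 𝔼)} [IsProbabilityMeasure π] (t : 𝔼) :
    ‖charFun (π.map Prod.fst) t - charFun (π.map Prod.snd) t‖ₑ ^ 2
      ≤ ‖t‖ₑ ^ 2 * ∫⁻ p, ‖p.1 - p.2‖ₑ ^ 2 ∂π := by
  have hexp : ∀ a b : ℝ, ‖Complex.exp (a * Complex.I) - Complex.exp (b * Complex.I)‖ ≤ |a - b| :=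
    fun a b => by
      have h : Complex.exp (a * Complex.I) - Complex.exp (b * Complex.I)
          = Complex.exp (b * Complex.I) * (Complex.exp (Complex.I * ((a - b : ℝ) : ℂ)) - 1) := by
        rw [mul_sub, ← Complex.exp_add, mul_one]
        congr 2
        push_cast
        ring
      rw [h, norm_mul, Complex.norm_exp_ofReal_mul_I, one_mul]
      exact Real.norm_exp_I_mul_ofReal_sub_one_le
  have hb : ∀ f : 𝔼 × 𝔼 → 𝔼, Measurable f →
      Integrable (fun p => Complex.exp (⟪f p, t⟫ * Complex.I)) π := fun f hf =>
    Integrable.of_bound (by fun_prop) 1 (.of_forall fun p => by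
      rw [Complex.norm_exp_ofReal_mul_I])
  have h1 : ‖charFun (π.map Prod.fst) t - charFun (π.map Prod.snd) t‖ₑ
      ≤ ‖t‖ₑ * ∫⁻ p, ‖p.1 - p.2‖ₑ ∂π := by
    rw [charFun_apply, charFun_apply, integral_map (by fun_prop) (by fun_prop),
      integral_map (by fun_prop) (by fun_prop),
      ← integral_sub (hb _ measurable_fst) (hb _ measurable_snd),
      ← lintegral_const_mul _ (by fun_prop)]
    refine (enorm_integral_le_lintegral_enorm _).trans (lintegral_mono fun p => ?_)
    rw [← ofReal_norm, ← ofReal_norm, ← ofReal_norm, ← ENNReal.ofReal_mul (norm_nonneg _)]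
    refine ENNReal.ofReal_le_ofReal ((hexp _ _).trans ?_)
    rw [← inner_sub_left, mul_comm]
    exact abs_real_inner_le_norm _ _
  have h2 : (∫⁻ p, ‖p.1 - p.2‖ₑ ∂π) ^ 2 ≤ ∫⁻ p, ‖p.1 - p.2‖ₑ ^ 2 ∂π := by
    have := ENNReal.lintegral_mul_le_Lp_mul_Lq π Real.HolderConjugate.two_two
      (f := fun p : 𝔼 × 𝔼 => ‖p.1 - p.2‖ₑ) (g := fun _ => 1) (by fun_prop) (by fun_prop)
    have h3 := pow_le_pow_left' this 2
    simpa [← ENNReal.rpow_mul_natCast] using h3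
  calc _ ≤ (‖t‖ₑ * ∫⁻ p, ‖p.1 - p.2‖ₑ ∂π) ^ 2 := by gcongr
    _ ≤ _ := by rw [mul_pow]; gcongr

theorem eq_of_wassersteinSq_eq_zero {μ ν : Measure 𝔼} [hμ : IsProbabilityMeasure μ]
    [IsProbabilityMeasure ν] (h : wassersteinSq μ ν = 0) : μ = ν := by
  refine Measure.ext_of_charFun (funext fun t => ?_)
  have key : ‖charFun μ t - charFun ν t‖ₑ ^ 2 / (‖t‖ₑ ^ 2 + 1) ≤ wassersteinSq μ ν := by
    refine le_iInf₂ fun π hπ => ?_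
    have : IsProbabilityMeasure π := by
      constructor
      have h := hμ.measure_univ
      rwa [← hπ.1, Measure.map_apply measurable_fst .univ] at h
    rw [← hπ.1, ← hπ.2]
    refine ENNReal.div_le_of_le_mul' ((enorm_charFun_sub_sq_le t).trans ?_)
    gcongr
    exact le_self_add
  rw [h, nonpos_iff_eq_zero, ENNReal.div_eq_zero_iff] at key
  rcases key with key | key
  · simpa [sub_eq_zero] using key
  · simp at key

theorem memLp_of_wassersteinSq_ne_top {μ ν : Measure 𝔼} (hν : MemLp id 2 ν)
    (h : wassersteinSq μ ν ≠ ∞) : MemLp id 2 μ := by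
  obtain ⟨π, hπ⟩ := iInf_lt_iff.1 (lt_top_iff_ne_top.2 h)
  obtain ⟨⟨h1, h2⟩, hπ⟩ := iInf_lt_iff.1 hπ
  have l2 : MemLp (fun p : 𝔼 × 𝔼 => p.2) 2 π :=
    hν.comp_measurePreserving ⟨measurable_snd, h2⟩
  have l3 : MemLp (fun p : 𝔼 × 𝔼 => p.1 - p.2) 2 π := by
    refine ⟨by fun_prop, ?_⟩
    rw [eLpNorm_lt_top_iff_lintegral_rpow_enorm_lt_top two_ne_zero ENNReal.ofNat_ne_top]
    simpa using hπ
  have l1 := l3.add l2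
  rw [← h1, memLp_map_measure_iff (by fun_prop) measurable_fst.aemeasurable]
  refine l1.congr_norm (by fun_prop) (.of_forall fun p => ?_)
  simp

theorem wassersteinSq_multivariateGaussian_le (m x : 𝔼) {A P S : Matrix (Fin d) (Fin d) ℝ}
    (hP : P.PosDef) (hA : A.PosDef) (h : A * P * A = S) :
    0 ≤ ((1 - A) * P).trace + ((1 - A⁻¹) * S).trace + ‖m - x‖ ^ 2 ∧
    wassersteinSq (multivariateGaussian m P) (multivariateGaussian x S) ≤
      ENNReal.ofReal (((1 - A) * P).trace + ((1 - A⁻¹) * S).trace + ‖m - x‖ ^ 2) := by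
  have hS : S.PosDef := h ▸ hA.mul_mul_self hP
  have hm : Measurable fun z : 𝔼 => (z, x + 𝐋 A (z - m)) := by fun_prop
  have hm2 : Measurable fun z : 𝔼 => x + 𝐋 A (z - m) := by fun_prop
  set π := (multivariateGaussian m P).map fun z => (z, x + 𝐋 A (z - m)) with hπ
  have h1 : π.map Prod.fst = multivariateGaussian m P := by
    rw [hπ, Measure.map_map measurable_fst hm]
    exact Measure.map_id
  have h2 : π.map Prod.snd = multivariateGaussian x S := by
    rw [hπ, Measure.map_map measurable_snd hm, ← h,
      ← map_affine_multivariateGaussian m x hP.posSemidef hA.isHermitian]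
    rfl
  have hη := hasMeanCov_multivariateGaussian m hP.posSemidef
  have hρ := hasMeanCov_multivariateGaussian x hS.posSemidef
  have h0 : ∫ p, ⟪p.1 - (m + 𝐋 A⁻¹ (p.2 - x)), 𝐋 A (p.1 - (m + 𝐋 A⁻¹ (p.2 - x)))⟫ ∂π = 0 := by
    rw [hπ, integral_map hm.aemeasurable (by fun_prop)]
    simp [toEuclideanCLM_apply_inv hA, -map_sub]
  have e1 := (integral_norm_sub_sq_of_coupling hη hρ hA h1 h2).2.2
  have e2 := lintegral_enorm_sub_sq_of_coupling hη hρ hA h1 h2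
  rw [h0, add_zero] at e1 e2
  exact ⟨e1 ▸ integral_nonneg fun p => by positivity, e2 ▸ wassersteinSq_le h1 h2⟩

/-- The replacement of a measure `η` by the Gaussian with the same mean, and with the same
covariance up to a multiple of the identity, does not increase the distance to another Gaussian
by more than an explicit amount. -/
theorem wassersteinSq_multivariateGaussian_add_le {η : Measure 𝔼} {m : 𝔼}
    {K : Matrix (Fin d) (Fin d) ℝ} (hη : HasMeanCov η m K) (x : 𝔼)
    {A P S : Matrix (Fin d) (Fin d) ℝ} {t c : ℝ} (ht : 0 ≤ t) (hc : 0 ≤ c)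
    (hPK : P = K + t • 1) (hP : P.PosDef) (hA : A.PosDef) (h : A * P * A = S)
    (hcA : ∀ v : 𝔼, c * ‖v‖ ^ 2 ≤ ⟪v, 𝐋 A v⟫) :
    wassersteinSq (multivariateGaussian m P) (multivariateGaussian x S) +
      (ENNReal.ofReal c * wassersteinSq η (multivariateGaussian m P)
        + ENNReal.ofReal (t * A.trace)) ≤
      wassersteinSq η (multivariateGaussian x S) + ENNReal.ofReal (t * d) := by
  have hS : S.PosDef := h ▸ hA.mul_mul_self hP
  have hρ := hasMeanCov_multivariateGaussian x hS.posSemidef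
  obtain ⟨hC, hW⟩ := wassersteinSq_multivariateGaussian_le m x hP hA h
  -- Moving `t d` to the left leaves only the infimum on the right, so a single coupling of `η` with
  -- the reference can be fixed.
  refine tsub_le_iff_right.1 (le_iInf₂ fun π hπ => tsub_le_iff_right.2 ?_)
  obtain ⟨h1, h2⟩ := hπ
  obtain ⟨-, i3, -⟩ := integral_norm_sub_sq_of_coupling hη hρ hA h1 h2
  rw [lintegral_enorm_sub_sq_of_coupling hη hρ hA h1 h2]
  set I := ∫ p, ⟪p.1 - (m + 𝐋 A⁻¹ (p.2 - x)), 𝐋 A (p.1 - (m + 𝐋 A⁻¹ (p.2 - x)))⟫ ∂π with hI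
  have hI0 : 0 ≤ I := integral_nonneg fun p => hA.posSemidef.inner_toEuclideanCLM_nonneg _
  have hSP : A⁻¹ * S * A⁻¹ = P := by
    have hu : IsUnit A.det := (isUnit_iff_isUnit_det _).1 hA.isUnit
    rw [← h, Matrix.mul_assoc A, nonsing_inv_mul_cancel_left _ _ hu,
      mul_nonsing_inv_cancel_right _ _ hu]
  have hm : Measurable fun p : 𝔼 × 𝔼 => m + 𝐋 A⁻¹ (p.2 - x) := by fun_prop
  have hmap : π.map (fun p : 𝔼 × 𝔼 => m + 𝐋 A⁻¹ (p.2 - x)) = multivariateGaussian m P := by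
    rw [← hSP, ← map_affine_multivariateGaussian x m hS.posSemidef hA.inv.isHermitian, ← h2,
      Measure.map_map (by fun_prop) measurable_snd]
    rfl
  -- Under `π`, the pair `(p.1, m + A⁻¹ (p.2 - x))` couples `η` with `N(m, P)`, and the deficit
  -- dominates `c` times its cost.
  have hcW : ENNReal.ofReal c * wassersteinSq η (multivariateGaussian m P)
      ≤ ENNReal.ofReal I := by
    rw [← hmap, ← h1]
    refine (mul_le_mul_right (wassersteinSq_map_le measurable_fst hm) _).trans ?_
    rw [← lintegral_const_mul _ (by fun_prop), hI, ofReal_integral_eq_lintegral_ofReal i3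
      (.of_forall fun p => hA.posSemidef.inner_toEuclideanCLM_nonneg _)]
    refine lintegral_mono fun p => ?_
    rw [← ofReal_norm, ← ENNReal.ofReal_pow (norm_nonneg _), ← ENNReal.ofReal_mul hc]
    exact ENNReal.ofReal_le_ofReal (hcA _)
  have hCC : ((1 - A) * P).trace = ((1 - A) * K).trace + t * d - t * A.trace := by
    rw [hPK, Matrix.mul_add, trace_add, Matrix.mul_smul, trace_smul, Matrix.mul_one, trace_sub,
      trace_one, Fintype.card_fin, smul_eq_mul]
    ring
  have htA : 0 ≤ t * A.trace := mul_nonneg ht hA.posSemidef.trace_nonneg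
  calc _ ≤ ENNReal.ofReal (((1 - A) * P).trace + ((1 - A⁻¹) * S).trace + ‖m - x‖ ^ 2)
        + (ENNReal.ofReal I + ENNReal.ofReal (t * A.trace)) := by gcongr
    _ = ENNReal.ofReal (((1 - A) * K).trace + ((1 - A⁻¹) * S).trace + ‖m - x‖ ^ 2 + I
        + t * d) := by
        rw [← ENNReal.ofReal_add hI0 htA, ← ENNReal.ofReal_add hC (by positivity), hCC]
        congr 1
        ring
    _ ≤ _ := ENNReal.ofReal_add_le

/-! ## Barycenters of Gaussians -/

theorem continuous_inner_toEuclideanCLM (v : 𝔼) :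
    Continuous fun S : SPDMatrix d => ⟪v, 𝐋 S.1 v⟫ := by
  simp only [inner_toEuclideanCLM]
  fun_prop

/-- The countably many closed sets `S ≥ 1 / (n + 1)` exhaust the positive definite matrices, so one
of them carries mass. -/
theorem exists_measurableSet_uniform_lower_bound (w : Measure (𝔼 × SPDMatrix d)) [NeZero w] :
    ∃ σ > 0, ∃ s : Set (𝔼 × SPDMatrix d), MeasurableSet s ∧ w s ≠ 0 ∧
      ∀ p ∈ s, ∀ v : 𝔼, σ * ‖v‖ ^ 2 ≤ ⟪v, 𝐋 p.2.1 v⟫ := by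
  let s : ℕ → Set (SPDMatrix d) := fun n =>
    {S | ∀ v : 𝔼, 1 / ((n : ℝ) + 1) * ‖v‖ ^ 2 ≤ ⟪v, 𝐋 S.1 v⟫}
  have hs : ∀ n, IsClosed (s n) := fun n => by
    simp only [s, Set.ofPred_forall]
    exact isClosed_iInter fun v => isClosed_le continuous_const
      (continuous_inner_toEuclideanCLM v)
  have hU : ⋃ n, (Prod.snd ⁻¹' s n : Set (𝔼 × SPDMatrix d)) = Set.univ := by
    refine Set.eq_univ_of_forall fun p => Set.mem_iUnion.2 ?_
    obtain ⟨σ, hσ0, hσ⟩ := p.2.2.exists_lower_bound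
    obtain ⟨n, hn⟩ := exists_nat_one_div_lt hσ0
    exact ⟨n, fun v => (mul_le_mul_of_nonneg_right hn.le (by positivity)).trans (hσ v)⟩
  obtain ⟨n, hn⟩ : ∃ n, w (Prod.snd ⁻¹' s n) ≠ 0 := by
    by_contra! hcon
    have := measure_iUnion_null hcon
    rw [hU] at this
    exact NeZero.ne w (Measure.measure_univ_eq_zero.1 this)
  exact ⟨1 / ((n : ℝ) + 1), by positivity, _, measurable_snd (hs n).measurableSet, hn,
    fun p hp => hp⟩

theorem exists_hasMeanCov_of_barycenter {η : ProbabilityMeasure 𝔼}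
    {w : ProbabilityMeasure (𝔼 × SPDMatrix d)}
    (h : ∫⁻ i, wassersteinSq (η : Measure 𝔼) (gaussianFamily d i) ∂(w : Measure _) ≠ ∞) :
    ∃ m K, HasMeanCov (η : Measure 𝔼) m K := by
  refine exists_hasMeanCov ?_
  by_contra hcon
  refine h ?_
  have : ∀ i, wassersteinSq (η : Measure 𝔼) (gaussianFamily d i) = ∞ := fun i => by
    by_contra hi
    exact hcon (memLp_of_wassersteinSq_ne_top
      (ν := multivariateGaussian i.1 i.2.1) IsGaussian.memLp_two_id hi)
  simp [this]

/-- Minimality of `η` against the Gaussians with the same mean. -/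
theorem lintegral_le_of_isFiniteMinimizer {η : ProbabilityMeasure 𝔼}
    {w : ProbabilityMeasure (𝔼 × SPDMatrix d)}
    (h : IsFiniteMinimizer (fun ν : ProbabilityMeasure 𝔼 =>
      ∫⁻ i, wassersteinSq (ν : Measure 𝔼) (gaussianFamily d i) ∂(w : Measure _)) η)
    {m : 𝔼} {K P : Matrix (Fin d) (Fin d) ℝ} (hη : HasMeanCov (η : Measure 𝔼) m K) {t : ℝ}
    (ht : 0 ≤ t) (hPK : P = K + t • 1) (hP : P.PosDef)
    {a b : ℝ} {s : Set (𝔼 × SPDMatrix d)} (hs : MeasurableSet s) (hb : 0 ≤ b)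
    (hab : ∀ p ∈ s, ∀ A : Matrix (Fin d) (Fin d) ℝ, A.PosDef → A * P * A = p.2.1 →
      a ≤ t * A.trace ∧ ∀ v : 𝔼, b * ‖v‖ ^ 2 ≤ ⟪v, 𝐋 A v⟫) :
    (ENNReal.ofReal b * wassersteinSq (η : Measure 𝔼) (multivariateGaussian m P)
      + ENNReal.ofReal a) * (w : Measure _) s ≤ ENNReal.ofReal (t * d) := by
  set γ : ProbabilityMeasure 𝔼 := ⟨multivariateGaussian m P, inferInstance⟩ with hγ
  set C := ENNReal.ofReal b * wassersteinSq (η : Measure 𝔼) (multivariateGaussian m P)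
      + ENNReal.ofReal a with hC
  have key : ∀ i, wassersteinSq (γ : Measure 𝔼) (gaussianFamily d i) + s.indicator (fun _ => C) i
      ≤ wassersteinSq (η : Measure 𝔼) (gaussianFamily d i) + ENNReal.ofReal (t * d) := by
    intro i
    obtain ⟨A, hA, hAP⟩ := exists_posDef_mul_mul_eq hP i.2.2
    by_cases hi : i ∈ s
    · rw [Set.indicator_of_mem hi]
      obtain ⟨ha, hb'⟩ := hab i hi A hA hAP
      refine le_trans ?_ (wassersteinSq_multivariateGaussian_add_le hη i.1 ht hb hPK hP hA hAP hb')
      rw [hC]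
      gcongr
      exact le_rfl
    · rw [Set.indicator_of_notMem hi]
      -- Outside `s` no uniform bound is available, and the trivial constant `0` suffices.
      refine le_trans ?_ (wassersteinSq_multivariateGaussian_add_le hη i.1 ht le_rfl hPK hP hA hAP
        fun v => by simpa using hA.posSemidef.inner_toEuclideanCLM_nonneg v)
      gcongr
      · exact le_rfl
      · exact zero_le
  -- Superadditivity of the lower integral avoids measurability of the distance in `i`.
  have h1 := (le_lintegral_add _ _).trans
    (lintegral_mono (μ := (w : Measure (𝔼 × SPDMatrix d))) key)
  rw [lintegral_add_right _ measurable_const, lintegral_indicator_const hs, lintegral_const,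
    measure_univ, mul_one] at h1
  have h2 := (add_le_add_left (h.2 γ) _).trans h1
  exact (ENNReal.add_le_add_iff_left h.1).1 h2

theorem w2BCM_gaussianFamily_subset : w2BCM (gaussianFamily d) ⊆ Set.range (gaussianFamily d) := by
  rintro η ⟨w, h⟩
  obtain ⟨m, K, hη⟩ := exists_hasMeanCov_of_barycenter h.1
  obtain ⟨σ, hσ0, s, hs, hws, hσ⟩ :=
    exists_measurableSet_uniform_lower_bound (w : Measure (𝔼 × SPDMatrix d))
  have hK : K.PosDef := by
    refine posDef_of_inner_toEuclideanCLM_pos hη.posSemidef.isHermitian fun v hv => ?_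
    refine (hη.posSemidef.inner_toEuclideanCLM_nonneg v).lt_of_ne' fun hv0 => ?_
    -- Regularize with `t = r²`. Along the kernel vector `v` the form of `P` is `r² ‖v‖²`, so `√σ ≤
    -- r tr A` on `s`: a gain of at least `r √σ` there against a loss of `r² d`.
    have key : ∀ r > 0, Real.sqrt σ * (w : Measure (𝔼 × SPDMatrix d)).real s ≤ r * d := by
      intro r hr
      have hP : (K + (r ^ 2) • (1 : Matrix (Fin d) (Fin d) ℝ)).PosDef :=
        PosDef.posSemidef_add hη.posSemidef (PosDef.one.smul (by positivity))
      have := lintegral_le_of_isFiniteMinimizer h hη (sq_nonneg r) rfl hP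
        (a := r * Real.sqrt σ) (b := 0) hs le_rfl (fun p hp A hA hAP => by
          refine ⟨?_, fun v => by simpa using hA.posSemidef.inner_toEuclideanCLM_nonneg v⟩
          have h1 := mul_norm_sq_le_of_mul_mul_eq hA hAP hσ0.le (hσ p hp) hv (t := r ^ 2) (by
            simp [map_add, inner_add_right, hv0, inner_smul_right])
          have h2 : Real.sqrt σ ≤ r * A.trace := by
            refine Real.sqrt_le_iff.2 ⟨mul_nonneg hr.le hA.posSemidef.trace_nonneg, ?_⟩
            rwa [mul_pow]
          calc r * Real.sqrt σ ≤ r * (r * A.trace) := by gcongr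
            _ = _ := by ring)
      rw [ENNReal.ofReal_zero, zero_mul, zero_add] at this
      have h3 := ENNReal.toReal_mono ENNReal.ofReal_ne_top this
      rw [ENNReal.toReal_mul, ENNReal.toReal_ofReal (by positivity),
        ENNReal.toReal_ofReal (by positivity)] at h3
      refine le_of_mul_le_mul_left ?_ hr
      calc _ = _ := by rw [← mul_assoc]; rfl
        _ ≤ _ := h3
        _ = _ := by ring
    have hq : 0 < Real.sqrt σ * (w : Measure (𝔼 × SPDMatrix d)).real s :=
      mul_pos (Real.sqrt_pos.2 hσ0) (ENNReal.toReal_pos hws (measure_ne_top _ _))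
    -- With `q = √σ w(s)` and `r = q / (d + 1)` this reads `q ≤ q d / (d + 1)`, which is absurd for
    -- `q > 0`.
    have := key _ (div_pos hq (by positivity : (0 : ℝ) < d + 1))
    rw [div_mul_eq_mul_div, le_div_iff₀ (by positivity)] at this
    linarith
  obtain ⟨c, hc0, hc⟩ := exists_uniform_lower_bound hK hσ0
  -- Now `K` is nonsingular and `t = 0` is allowed: there is no loss, so the gain must vanish.
  have h0 := lintegral_le_of_isFiniteMinimizer h hη le_rfl (by simp) hK (a := 0) hs hc0.le
    (fun p hp A hA hAP => ⟨by simp, hc A _ hA hAP (hσ p hp)⟩)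
  have hW : wassersteinSq (η : Measure 𝔼) (multivariateGaussian m K) = 0 := by
    simpa [hws, hc0.not_ge] using h0
  exact ⟨(m, ⟨K, hK⟩), Subtype.ext (eq_of_wassersteinSq_eq_zero hW).symm⟩

/-! ## Optimal transport maps between Gaussians -/

section AffineMap

variable {A P : Matrix (Fin d) (Fin d) ℝ} (x₀ b : EuclideanSpace ℝ (Fin d))

theorem transportCost_eq_of_map_eq (hP : P.PosDef) (hA : A.PosDef) {T : 𝔼 → 𝔼}
    (hT : Measurable T)
    (hmap : (multivariateGaussian x₀ P).map T = multivariateGaussian b (A * P * A)) :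
    Integrable (fun z => ⟪z - (x₀ + 𝐋 A⁻¹ (T z - b)), 𝐋 A (z - (x₀ + 𝐋 A⁻¹ (T z - b)))⟫)
      (multivariateGaussian x₀ P) ∧
    transportCost (multivariateGaussian x₀ P) T = ENNReal.ofReal
      (((1 - A) * P).trace + ((1 - A⁻¹) * (A * P * A)).trace + ‖x₀ - b‖ ^ 2 +
        ∫ z, ⟪z - (x₀ + 𝐋 A⁻¹ (T z - b)), 𝐋 A (z - (x₀ + 𝐋 A⁻¹ (T z - b)))⟫
          ∂(multivariateGaussian x₀ P)) := by
  have hm : Measurable fun z : 𝔼 => (z, T z) := measurable_id.prodMk hT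
  set π := (multivariateGaussian x₀ P).map fun z => (z, T z) with hπ
  have h1 : π.map Prod.fst = multivariateGaussian x₀ P := by
    rw [hπ, Measure.map_map measurable_fst hm]
    exact Measure.map_id
  have h2 : π.map Prod.snd = multivariateGaussian b (A * P * A) := by
    rw [hπ, Measure.map_map measurable_snd hm, ← hmap]
    rfl
  have hη := hasMeanCov_multivariateGaussian x₀ hP.posSemidef
  have hρ := hasMeanCov_multivariateGaussian b (hA.mul_mul_self hP).posSemidef
  have hq : Measurable fun p : 𝔼 × 𝔼 =>
      ⟪p.1 - (x₀ + 𝐋 A⁻¹ (p.2 - b)), 𝐋 A (p.1 - (x₀ + 𝐋 A⁻¹ (p.2 - b)))⟫ := by fun_prop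
  have e1 := (integrable_map_measure hq.aestronglyMeasurable hm.aemeasurable).1
    (integral_norm_sub_sq_of_coupling hη hρ hA h1 h2).2.1
  have e2 := lintegral_enorm_sub_sq_of_coupling hη hρ hA h1 h2
  rw [hπ, integral_map hm.aemeasurable hq.aestronglyMeasurable,
    lintegral_map (by fun_prop) hm] at e2
  refine ⟨e1, ?_⟩
  rw [← e2, transportCost]
  exact lintegral_congr fun z => by rw [enorm_sub_rev]

theorem isOptimalTransportMap_affine (hP : P.PosDef) (hA : A.PosDef) :
    IsOptimalTransportMap (multivariateGaussian x₀ P) (multivariateGaussian b (A * P * A))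
      (fun z => b + 𝐋 A (z - x₀)) ∧
    ∀ T, IsOptimalTransportMap (multivariateGaussian x₀ P) (multivariateGaussian b (A * P * A)) T →
      T =ᵐ[multivariateGaussian x₀ P] fun z => b + 𝐋 A (z - x₀) := by
  have hm : Measurable fun z : 𝔼 => b + 𝐋 A (z - x₀) := by fun_prop
  have hmap := map_affine_multivariateGaussian x₀ b hP.posSemidef hA.isHermitian
  have hC := (wassersteinSq_multivariateGaussian_le x₀ b hP hA rfl).1
  have h0 := (transportCost_eq_of_map_eq x₀ b hP hA hm hmap).2
  simp only [add_sub_cancel_left, toEuclideanCLM_apply_inv hA, add_sub_cancel, sub_self,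
    inner_zero_left, integral_zero, add_zero] at h0
  have hI : ∀ T : 𝔼 → 𝔼,
      0 ≤ ∫ z, ⟪z - (x₀ + 𝐋 A⁻¹ (T z - b)), 𝐋 A (z - (x₀ + 𝐋 A⁻¹ (T z - b)))⟫
          ∂(multivariateGaussian x₀ P) := fun T =>
    integral_nonneg fun z => hA.posSemidef.inner_toEuclideanCLM_nonneg _
  have hopt : IsOptimalTransportMap (multivariateGaussian x₀ P)
      (multivariateGaussian b (A * P * A)) (fun z => b + 𝐋 A (z - x₀)) :=
    { measurable := hm
      map_eq := hmap
      cost_ne_top := by rw [h0]; exact ENNReal.ofReal_ne_top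
      cost_le := fun T hT hTm => by
        rw [h0, (transportCost_eq_of_map_eq x₀ b hP hA hT hTm).2]
        exact ENNReal.ofReal_le_ofReal (le_add_of_nonneg_right (hI T)) }
  refine ⟨hopt, fun T hT => ?_⟩
  -- Compared with the affine map, an optimal `T` must have zero deficit; as `A` is positive
  -- definite, this determines `T` almost everywhere.
  have hle := hT.cost_le _ hm hmap
  obtain ⟨i1, h1⟩ := transportCost_eq_of_map_eq x₀ b hP hA hT.measurable hT.map_eq
  rw [h0, h1, ENNReal.ofReal_le_ofReal_iff hC] at hle
  have hz := (integral_eq_zero_iff_of_nonneg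
    (fun z => hA.posSemidef.inner_toEuclideanCLM_nonneg _) i1).1
    (le_antisymm (by linarith) (hI T))
  filter_upwards [hz] with z hz
  have hw : z - (x₀ + 𝐋 A⁻¹ (T z - b)) = 0 := by
    by_contra hne
    exact (hA.inner_toEuclideanCLM_pos hne).ne' hz
  have h2 : 𝐋 A⁻¹ (T z - b) = z - x₀ := by
    rw [← sub_eq_zero, ← neg_eq_zero, ← hw]
    abel
  rw [← h2, toEuclideanCLM_inv_apply hA, add_sub_cancel]

theorem optimalTransportMap_spec {μ ν : Measure 𝔼} (h : ∃ T, IsOptimalTransportMap μ ν T) :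
    IsOptimalTransportMap μ ν (optimalTransportMap μ ν) := by
  rw [optimalTransportMap, dif_pos h]
  exact h.choose_spec

theorem linearOTSq_eq_lintegral {μ₀ ν ρ : Measure 𝔼} {T S : 𝔼 → 𝔼}
    (hT : IsOptimalTransportMap μ₀ ν T) (hS : IsOptimalTransportMap μ₀ ρ S)
    (hT' : optimalTransportMap μ₀ ν =ᵐ[μ₀] T) (hS' : optimalTransportMap μ₀ ρ =ᵐ[μ₀] S) :
    linearOTSq μ₀ ν ρ = ∫⁻ x, ‖T x - S x‖ₑ ^ 2 ∂μ₀ := by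
  rw [linearOTSq, if_pos ⟨⟨T, hT⟩, ⟨S, hS⟩⟩]
  refine lintegral_congr_ae ?_
  filter_upwards [hT', hS'] with x h1 h2
  rw [h1, h2]

end AffineMap

/-! ## Measurable dependence of the optimal map on the covariance matrix -/

theorem isClosed_setOf_posSemidef : IsClosed {S : Matrix (Fin d) (Fin d) ℝ | S.PosSemidef} := by
  simp only [posSemidef_iff_dotProduct_mulVec, Set.ofPred_and, Set.ofPred_forall]
  refine IsClosed.inter (isClosed_eq (by fun_prop) continuous_id)
    (isClosed_iInter fun v => isClosed_le continuous_const (by fun_prop))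

instance SPDMatrix.instPolishSpace : PolishSpace (SPDMatrix d) := by
  have : PolishSpace (Matrix (Fin d) (Fin d) ℝ) :=
    inferInstanceAs (PolishSpace (Fin d → Fin d → ℝ))
  -- Recording the inverse determinant makes the image closed: it is cut out by semidefiniteness and
  -- `det S * r = 1`.
  let f : SPDMatrix d → Matrix (Fin d) (Fin d) ℝ × ℝ := fun S => (S.1, S.1.det⁻¹)
  have hf : Continuous f := continuous_subtype_val.prodMk
    ((continuous_subtype_val.matrix_det).inv₀ fun S => S.2.det_pos.ne')
  have hi : Topology.IsInducing f := by
    refine Topology.IsInducing.of_comp hf continuous_fst ?_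
    exact Topology.IsInducing.subtypeVal
  have hinj : Function.Injective f := fun S T h => Subtype.ext (congrArg Prod.fst h)
  refine Topology.IsClosedEmbedding.polishSpace (f := f) ⟨⟨hi, hinj⟩, ?_⟩
  have hr : Set.range f = {q | q.1.PosSemidef} ∩ {q | q.1.det * q.2 = 1} := by
    ext ⟨S, r⟩
    constructor
    · rintro ⟨T, hT⟩
      obtain ⟨rfl, rfl⟩ := Prod.ext_iff.1 hT
      exact ⟨T.2.posSemidef, mul_inv_cancel₀ T.2.det_pos.ne'⟩
    · rintro ⟨h1 : S.PosSemidef, h2 : S.det * r = 1⟩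
      have h3 : S.det ≠ 0 := left_ne_zero_of_mul_eq_one h2
      exact ⟨⟨S, h1.posDef_iff_det_ne_zero.2 h3⟩, Prod.ext rfl (inv_eq_of_mul_eq_one_right h2)⟩
  rw [hr]
  exact (isClosed_setOf_posSemidef.preimage continuous_fst).inter
    (isClosed_eq (by fun_prop) continuous_const)

/-- `A ↦ A P A` is a continuous bijection of a Polish space onto itself, so by Lusin–Souslin its
inverse is Borel. -/
theorem exists_measurable_mul_mul_eq {P : Matrix (Fin d) (Fin d) ℝ} (hP : P.PosDef) :
    ∃ α : SPDMatrix d → SPDMatrix d, Measurable α ∧ ∀ S, (α S).1 * P * (α S).1 = S.1 := by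
  let f : SPDMatrix d → SPDMatrix d := fun A => ⟨A.1 * P * A.1, A.2.mul_mul_self hP⟩
  have hf : Continuous f := by
    refine Continuous.subtype_mk ?_ _
    fun_prop
  have hinj : Function.Injective f := fun A B h =>
    Subtype.ext (eq_of_posDef_mul_mul_eq hP A.2 B.2 (congrArg Subtype.val h))
  have hsurj : Function.Surjective f := fun S => by
    obtain ⟨A, hA, h⟩ := exists_posDef_mul_mul_eq hP S.2
    exact ⟨⟨A, hA⟩, Subtype.ext h⟩
  have he := hf.measurableEmbedding hinj
  refine ⟨Function.surjInv hsurj, fun s hs => ?_,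
    fun S => congrArg Subtype.val (Function.surjInv_eq hsurj S)⟩
  have : Function.surjInv hsurj ⁻¹' s = f '' s := by
    ext S
    constructor
    · exact fun h => ⟨_, h, Function.surjInv_eq hsurj S⟩
    · rintro ⟨A, hA, rfl⟩
      have := hinj (Function.surjInv_eq hsurj (f A))
      rwa [Set.mem_preimage, this]
  rw [this]
  exact he.measurableSet_image.2 hs

theorem measurable_toEuclideanCLM_apply {Ω : Type*} [MeasurableSpace Ω] {f : Ω → SPDMatrix d}
    {g : Ω → 𝔼} (hf : Measurable f) (hg : Measurable g) :
    Measurable fun a => 𝐋 (f a).1 (g a) := by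
  have h : Continuous fun q : SPDMatrix d × 𝔼 => WithLp.toLp 2 (q.1.1 *ᵥ q.2.ofLp) := by
    fun_prop
  have h2 : Measurable fun a => WithLp.toLp 2 ((f a).1 *ᵥ (g a).ofLp) :=
    h.measurable.comp (hf.prodMk hg)
  exact h2

/-! ## Linear barycenters of Gaussians -/

/-- The cross term vanishes because `Z` minus its mean integrates to zero. -/
theorem enorm_sub_sq_add_lintegral_eq {Ω : Type*} [MeasurableSpace Ω] {w : Measure Ω}
    [IsProbabilityMeasure w] {Z : Ω → 𝔼} (hZ : MemLp Z 2 w) (c : 𝔼) :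
    ‖c - ∫ i, Z i ∂w‖ₑ ^ 2 + ∫⁻ i, ‖(∫ i, Z i ∂w) - Z i‖ₑ ^ 2 ∂w
      = ∫⁻ i, ‖c - Z i‖ₑ ^ 2 ∂w := by
  set e := ∫ i, Z i ∂w with he
  have h2 : ∀ c : 𝔼, ∫⁻ i, ‖c - Z i‖ₑ ^ 2 ∂w = ENNReal.ofReal (∫ i, ‖c - Z i‖ ^ 2 ∂w) := by
    intro c
    have hI : Integrable (fun i => ‖c - Z i‖ ^ 2) w :=
      ((memLp_const c).sub hZ).integrable_norm_pow two_ne_zero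
    rw [ofReal_integral_eq_lintegral_ofReal hI (.of_forall fun i => by positivity)]
    simp only [ENNReal.ofReal_pow (norm_nonneg _), ofReal_norm]
  have hi : Integrable Z w := hZ.integrable one_le_two
  rw [h2, h2, ← ofReal_norm, ← ENNReal.ofReal_pow (norm_nonneg _),
    ← ENNReal.ofReal_add (by positivity) (integral_nonneg fun i => by positivity)]
  congr 1
  have hp : ∀ i, ‖c - Z i‖ ^ 2 = ‖c - e‖ ^ 2 + ‖e - Z i‖ ^ 2 + 2 * ⟪c - e, e - Z i⟫ := by
    intro i
    rw [← sub_add_sub_cancel c e (Z i), norm_add_sq_real]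
    ring
  have j1 : Integrable (fun i => ‖e - Z i‖ ^ 2) w :=
    ((memLp_const e).sub hZ).integrable_norm_pow two_ne_zero
  have j2 : Integrable (fun i => e - Z i) w := (integrable_const e).sub hi
  have j3 : Integrable (fun i => ‖c - e‖ ^ 2 + ‖e - Z i‖ ^ 2) w := (integrable_const _).add j1
  simp_rw [hp]
  rw [integral_add j3 ((j2.const_inner _).const_mul _), integral_add (integrable_const _) j1,
    integral_const_mul, integral_inner j2,
    integral_sub (integrable_const _) hi, ← he]
  simp

theorem lintegral_enorm_sq_multivariateGaussian (x : 𝔼) {S : Matrix (Fin d) (Fin d) ℝ}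
    (hS : S.PosSemidef) :
    ∫⁻ y, ‖y‖ₑ ^ 2 ∂(multivariateGaussian x S) = ENNReal.ofReal (‖x‖ ^ 2 + S.trace) := by
  have h := enorm_sub_sq_add_lintegral_eq (w := multivariateGaussian x S) (Z := fun y => y)
    IsGaussian.memLp_two_id 0
  have hc := hasMeanCov_multivariateGaussian x hS
  have hq := hc.integral_quadratic 1
  have hi := hc.integrable_quadratic 1
  simp only [map_one, one_apply_eq_self, real_inner_self_eq_norm_sq, Matrix.one_mul] at hq hi
  simp only [zero_sub, enorm_neg, integral_id_multivariateGaussian] at h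
  rw [← h, ENNReal.ofReal_add (by positivity) hS.trace_nonneg, ← hq,
    ofReal_integral_eq_lintegral_ofReal hi (.of_forall fun y => by positivity)]
  simp only [ENNReal.ofReal_pow (norm_nonneg _), ofReal_norm, enorm_sub_rev]

theorem norm_toEuclideanCLM_sq_le_of_mul_mul_eq {A P S : Matrix (Fin d) (Fin d) ℝ}
    (hA : A.PosDef) (hS : S.PosDef) (h : A * P * A = S) {σ : ℝ} (hσ0 : 0 < σ)
    (hσ : ∀ v : 𝔼, σ * ‖v‖ ^ 2 ≤ ⟪v, 𝐋 P v⟫) (v : 𝔼) :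
    ‖𝐋 A v‖ ^ 2 ≤ σ⁻¹ * ‖v‖ ^ 2 * S.trace := by
  have h0 : ⟪𝐋 A v, 𝐋 P (𝐋 A v)⟫ = ⟪v, 𝐋 S v⟫ := by
    rw [← h, toEuclideanCLM_mul_apply, toEuclideanCLM_mul_apply,
      ← hA.isHermitian.inner_toEuclideanCLM_comm]
  have h1 := (hσ (𝐋 A v)).trans_eq h0
  have h2 := hS.posSemidef.inner_toEuclideanCLM_le_trace v
  rw [mul_assoc, ← div_eq_inv_mul, le_div_iff₀ hσ0]
  linarith

section LinearBarycenter

variable {w : Measure (EuclideanSpace ℝ (Fin d) × SPDMatrix d)}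
  {α : SPDMatrix d → SPDMatrix d} {P : Matrix (Fin d) (Fin d) ℝ}

theorem memLp_mean_of_secondMoment
    (hw : ∫⁻ i, ENNReal.ofReal (‖i.1‖ ^ 2 + i.2.1.trace) ∂w ≠ ∞) :
    MemLp (fun i : 𝔼 × SPDMatrix d => i.1) 2 w := by
  rw [memLp_two_iff_integrable_sq_norm (by fun_prop)]
  refine ⟨by fun_prop, ?_⟩
  rw [hasFiniteIntegral_iff_ofReal (.of_forall fun i => by positivity)]
  refine lt_of_le_of_lt (lintegral_mono fun i => ?_) (lt_top_iff_ne_top.2 hw)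
  exact ENNReal.ofReal_le_ofReal (le_add_of_nonneg_right i.2.2.posSemidef.trace_nonneg)

theorem memLp_linear_part_of_secondMoment (hP : P.PosDef) (hα : Measurable α)
    (hαP : ∀ S, (α S).1 * P * (α S).1 = S.1)
    (hw : ∫⁻ i, ENNReal.ofReal (‖i.1‖ ^ 2 + i.2.1.trace) ∂w ≠ ∞) (v : 𝔼) :
    MemLp (fun i : 𝔼 × SPDMatrix d => 𝐋 (α i.2).1 v) 2 w := by
  have hm : Measurable fun i : 𝔼 × SPDMatrix d => 𝐋 (α i.2).1 v :=
    measurable_toEuclideanCLM_apply (hα.comp measurable_snd) measurable_const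
  obtain ⟨σ, hσ0, hσ⟩ := hP.exists_lower_bound
  rw [memLp_two_iff_integrable_sq_norm hm.aestronglyMeasurable]
  refine ⟨(hm.norm.pow_const 2).aestronglyMeasurable, ?_⟩
  rw [hasFiniteIntegral_iff_ofReal (.of_forall fun i => by positivity)]
  have hfin : ENNReal.ofReal (σ⁻¹ * ‖v‖ ^ 2)
      * ∫⁻ i, ENNReal.ofReal (‖i.1‖ ^ 2 + i.2.1.trace) ∂w < ∞ :=
    ENNReal.mul_lt_top ENNReal.ofReal_lt_top (lt_top_iff_ne_top.2 hw)
  refine lt_of_le_of_lt ?_ hfin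
  rw [← lintegral_const_mul' _ _ ENNReal.ofReal_ne_top]
  refine lintegral_mono fun i => ?_
  rw [← ENNReal.ofReal_mul (by positivity)]
  refine ENNReal.ofReal_le_ofReal ?_
  refine (norm_toEuclideanCLM_sq_le_of_mul_mul_eq (α i.2).2 i.2.2 (hαP _) hσ0 hσ v).trans ?_
  gcongr
  exact le_add_of_nonneg_left (by positivity)

/-- The mean of the linear parts of the transport maps is positive definite. -/
theorem exists_posDef_integral_eq [IsProbabilityMeasure w]
    (hi : ∀ v : 𝔼, Integrable (fun i : 𝔼 × SPDMatrix d => 𝐋 (α i.2).1 v) w) :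
    ∃ A : Matrix (Fin d) (Fin d) ℝ, A.PosDef ∧ ∀ v : 𝔼, ∫ i, 𝐋 (α i.2).1 v ∂w = 𝐋 A v := by
  let Φ : 𝔼 →ₗ[ℝ] 𝔼 :=
    { toFun := fun v => ∫ i, 𝐋 (α i.2).1 v ∂w
      map_add' := fun u v => by
        simp only [map_add]
        exact integral_add (hi u) (hi v)
      map_smul' := fun c v => by
        simp only [map_smul]
        exact integral_smul c _ }
  obtain ⟨A, hA⟩ : ∃ A, 𝐋 A = Φ.toContinuousLinearMap :=
    ⟨_, (toEuclideanCLM (𝕜 := ℝ) (n := Fin d)).apply_symm_apply _⟩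
  have hAv : ∀ v : 𝔼, ∫ i, 𝐋 (α i.2).1 v ∂w = 𝐋 A v := fun v => by rw [hA]; rfl
  refine ⟨A, posDef_of_inner_toEuclideanCLM_pos ?_ fun v hv => ?_, hAv⟩
  · have hs : IsSelfAdjoint (𝐋 A) := by
      rw [ContinuousLinearMap.isSelfAdjoint_iff_isSymmetric]
      intro u v
      change ⟪𝐋 A u, v⟫ = ⟪u, 𝐋 A v⟫
      rw [← hAv, ← hAv, real_inner_comm, ← integral_inner (hi _), ← integral_inner (hi _)]
      refine integral_congr_ae (.of_forall fun i => ?_)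
      change ⟪v, 𝐋 (α i.2).1 u⟫ = ⟪u, 𝐋 (α i.2).1 v⟫
      rw [(α i.2).2.isHermitian.inner_toEuclideanCLM_comm, real_inner_comm]
    have : star A = A := by
      refine EquivLike.injective (toEuclideanCLM (𝕜 := ℝ) (n := Fin d)) ?_
      rw [map_star]
      exact hs
    exact this
  · have hpos : ∀ i : 𝔼 × SPDMatrix d, 0 < ⟪v, 𝐋 (α i.2).1 v⟫ := fun i =>
      (α i.2).2.inner_toEuclideanCLM_pos hv
    have hs : Function.support (fun i : 𝔼 × SPDMatrix d => ⟪v, 𝐋 (α i.2).1 v⟫) = Set.univ :=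
      Set.eq_univ_of_forall fun i => (hpos i).ne'
    have h0 : 0 ≤ fun i : 𝔼 × SPDMatrix d => ⟪v, 𝐋 (α i.2).1 v⟫ := fun i => (hpos i).le
    rw [← hAv, ← integral_inner (hi _),
      integral_pos_iff_support_of_nonneg h0 ((hi v).const_inner v), hs, measure_univ]
    exact zero_lt_one

/-- Bias-variance decomposition for a random affine map. -/
theorem exists_affine_lintegral_add_eq [IsProbabilityMeasure w] (hP : P.PosDef) (hα : Measurable α)
    (hαP : ∀ S, (α S).1 * P * (α S).1 = S.1)
    (hw : ∫⁻ i, ENNReal.ofReal (‖i.1‖ ^ 2 + i.2.1.trace) ∂w ≠ ∞) (x₀ : 𝔼)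
    (μ : Measure 𝔼) [IsProbabilityMeasure μ] {T : 𝔼 → 𝔼} (hT : Measurable T) :
    ∃ (b : 𝔼) (A : Matrix (Fin d) (Fin d) ℝ), A.PosDef ∧
      ∫⁻ x, ‖T x - (b + 𝐋 A (x - x₀))‖ₑ ^ 2 ∂μ
        + ∫⁻ i, ∫⁻ x, ‖(b + 𝐋 A (x - x₀)) - (i.1 + 𝐋 (α i.2).1 (x - x₀))‖ₑ ^ 2 ∂μ ∂w
      = ∫⁻ i, ∫⁻ x, ‖T x - (i.1 + 𝐋 (α i.2).1 (x - x₀))‖ₑ ^ 2 ∂μ ∂w := by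
  have l1 := memLp_mean_of_secondMoment hw
  have l2 := memLp_linear_part_of_secondMoment hP hα hαP hw
  obtain ⟨A, hA, hAv⟩ := exists_posDef_integral_eq fun v => (l2 v).integrable one_le_two
  have hm : Measurable fun q : (𝔼 × SPDMatrix d) × 𝔼 =>
      q.1.1 + 𝐋 (α q.1.2).1 (q.2 - x₀) :=
    (measurable_fst.comp measurable_fst).add (measurable_toEuclideanCLM_apply
      (hα.comp (measurable_snd.comp measurable_fst)) (measurable_snd.sub_const x₀))
  refine ⟨∫ i, i.1 ∂w, A, hA, ?_⟩
  -- By Tonelli the weight can be integrated first, which reduces the claim to the vector identity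
  -- at each point `x`.
  have hswap : ∀ R : 𝔼 → 𝔼, Measurable R →
      ∫⁻ i, ∫⁻ x, ‖R x - (i.1 + 𝐋 (α i.2).1 (x - x₀))‖ₑ ^ 2 ∂μ ∂w
        = ∫⁻ x, ∫⁻ i, ‖R x - (i.1 + 𝐋 (α i.2).1 (x - x₀))‖ₑ ^ 2 ∂w ∂μ := fun R hR =>
    lintegral_lintegral_swap
      (((hR.comp measurable_snd).sub hm).enorm.pow_const 2).aemeasurable
  rw [hswap T hT, hswap (fun x => (∫ i, i.1 ∂w) + 𝐋 A (x - x₀)) (by fun_prop),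
    ← lintegral_add_left (by fun_prop)]
  refine lintegral_congr fun x => ?_
  have he : ∫ i, (i.1 + 𝐋 (α i.2).1 (x - x₀)) ∂w = (∫ i, i.1 ∂w) + 𝐋 A (x - x₀) := by
    rw [integral_add (l1.integrable one_le_two) ((l2 _).integrable one_le_two), hAv]
  have := enorm_sub_sq_add_lintegral_eq (l1.add (l2 (x - x₀))) (T x)
  simp only [Pi.add_apply, he] at this
  exact this

end LinearBarycenter

theorem enorm_sq_le_two_mul {x y : 𝔼} : ‖x‖ₑ ^ 2 ≤ 2 * (‖x - y‖ₑ ^ 2 + ‖y‖ₑ ^ 2) := by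
  have h1 : ‖x‖ ^ 2 ≤ 2 * (‖x - y‖ ^ 2 + ‖y‖ ^ 2) := by
    have h := norm_add_le (x - y) y
    rw [sub_add_cancel] at h
    nlinarith [norm_nonneg x, sq_nonneg (‖x - y‖ - ‖y‖)]
  have h2 := ENNReal.ofReal_le_ofReal h1
  rw [ENNReal.ofReal_mul zero_le_two, ENNReal.ofReal_add (by positivity) (by positivity)] at h2
  simpa only [ENNReal.ofReal_pow (norm_nonneg _), ofReal_norm, ENNReal.ofReal_ofNat] using h2

theorem lBCM_gaussianFamily_subset (p₀ : 𝔼 × SPDMatrix d) :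
    lBCM (gaussianFamily d p₀) (gaussianFamily d) ⊆ Set.range (gaussianFamily d) := by
  rintro η ⟨w, hfin, hmin⟩
  obtain ⟨x₀, P, hP⟩ := p₀
  obtain ⟨α, hα, hαP⟩ := exists_measurable_mul_mul_eq hP
  let μ₀ := multivariateGaussian x₀ P
  let T : 𝔼 → 𝔼 := optimalTransportMap μ₀ η
  have hspec : ∀ (b : 𝔼) (A : Matrix (Fin d) (Fin d) ℝ), A.PosDef →
      IsOptimalTransportMap μ₀ (multivariateGaussian b (A * P * A)) (fun x => b + 𝐋 A (x - x₀)) ∧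
      optimalTransportMap μ₀ (multivariateGaussian b (A * P * A))
        =ᵐ[μ₀] fun x => b + 𝐋 A (x - x₀) := fun b A hA => by
    have h := isOptimalTransportMap_affine x₀ b hP hA
    exact ⟨h.1, h.2 _ (optimalTransportMap_spec ⟨_, h.1⟩)⟩
  have hcost : ∀ {ν : Measure 𝔼} {R : 𝔼 → 𝔼}, IsOptimalTransportMap μ₀ ν R →
      optimalTransportMap μ₀ ν =ᵐ[μ₀] R → ∀ i, linearOTSq μ₀ ν (gaussianFamily d i)
        = ∫⁻ x, ‖R x - (i.1 + 𝐋 (α i.2).1 (x - x₀))‖ₑ ^ 2 ∂μ₀ := by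
    intro ν R hR hR' i
    obtain ⟨h1, h2⟩ := hspec i.1 _ (α i.2).2
    rw [hαP] at h1 h2
    exact linearOTSq_eq_lintegral hR h1 hR' h2
  have hT : IsOptimalTransportMap μ₀ η T := by
    refine optimalTransportMap_spec ?_
    by_contra hcon
    refine hfin ?_
    have : ∀ i, linearOTSq (gaussianFamily d (x₀, ⟨P, hP⟩) : Measure 𝔼) η (gaussianFamily d i)
        = ∞ := fun i => if_neg fun h => hcon h.1
    simp [this]
  have hFη : ∫⁻ i, linearOTSq μ₀ η (gaussianFamily d i) ∂(w : Measure (𝔼 × SPDMatrix d))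
      = ∫⁻ i, ∫⁻ x, ‖T x - (i.1 + 𝐋 (α i.2).1 (x - x₀))‖ₑ ^ 2 ∂μ₀
        ∂(w : Measure (𝔼 × SPDMatrix d)) :=
    lintegral_congr fun i => hcost hT .rfl i
  have hfin' : ∫⁻ i, ∫⁻ x, ‖T x - (i.1 + 𝐋 (α i.2).1 (x - x₀))‖ₑ ^ 2 ∂μ₀
        ∂(w : Measure (𝔼 × SPDMatrix d)) ≠ ∞ := hFη ▸ hfin
  have hT2 : ∫⁻ x, ‖T x‖ₑ ^ 2 ∂μ₀ ≠ ∞ := by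
    have h1 : ∫⁻ x, ‖T x‖ₑ ^ 2 ∂μ₀ ≤ 2 * (transportCost μ₀ T + ∫⁻ x, ‖x‖ₑ ^ 2 ∂μ₀) := by
      rw [transportCost, ← lintegral_add_right _ (by fun_prop),
        ← lintegral_const_mul' _ _ ENNReal.ofNat_ne_top]
      exact lintegral_mono fun x => enorm_sq_le_two_mul
    refine ne_top_of_le_ne_top (ENNReal.mul_ne_top ENNReal.ofNat_ne_top
      (ENNReal.add_ne_top.2 ⟨hT.cost_ne_top, ?_⟩)) h1
    rw [lintegral_enorm_sq_multivariateGaussian x₀ hP.posSemidef]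
    exact ENNReal.ofReal_ne_top
  -- The integrand is the second moment of the reference, i.e. the squared `L²(μ₀)` norm of its
  -- optimal map. The finite objective and `T ∈ L²(μ₀)` bound its integral, so the averaged map
  -- exists.
  have hw : ∫⁻ i, ENNReal.ofReal (‖i.1‖ ^ 2 + i.2.1.trace) ∂(w : Measure (𝔼 × SPDMatrix d))
      ≠ ∞ := by
    have h1 : ∀ i : 𝔼 × SPDMatrix d, ENNReal.ofReal (‖i.1‖ ^ 2 + i.2.1.trace)
        ≤ 2 * (∫⁻ x, ‖T x - (i.1 + 𝐋 (α i.2).1 (x - x₀))‖ₑ ^ 2 ∂μ₀ + ∫⁻ x, ‖T x‖ₑ ^ 2 ∂μ₀) := by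
      intro i
      have h := (hspec i.1 _ (α i.2).2).1
      rw [← lintegral_enorm_sq_multivariateGaussian i.1 i.2.2.posSemidef, ← hαP i.2, ← h.map_eq,
        lintegral_map (by fun_prop) h.measurable,
        ← lintegral_add_right _ (hT.measurable.enorm.pow_const 2),
        ← lintegral_const_mul' _ _ ENNReal.ofNat_ne_top]
      refine lintegral_mono fun x => ?_
      rw [enorm_sub_rev (T x)]
      exact enorm_sq_le_two_mul
    refine ne_top_of_le_ne_top ?_ (lintegral_mono h1)
    rw [lintegral_const_mul' _ _ ENNReal.ofNat_ne_top, lintegral_add_right _ measurable_const,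
      lintegral_const, measure_univ, mul_one]
    exact ENNReal.mul_ne_top ENNReal.ofNat_ne_top (ENNReal.add_ne_top.2 ⟨hfin', hT2⟩)
  obtain ⟨b, A, hA, hdec⟩ := exists_affine_lintegral_add_eq hP hα hαP hw x₀ μ₀ hT.measurable
  obtain ⟨hA1, hA2⟩ := hspec b A hA
  -- The competitor is the image of the base under the averaged map; its objective is the variance
  -- term, so the bias of `T` is zero.
  have hle := hmin (gaussianFamily d (b, ⟨A * P * A, hA.mul_mul_self hP⟩))
  have hFν : ∫⁻ i, linearOTSq μ₀ (multivariateGaussian b (A * P * A)) (gaussianFamily d i)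
        ∂(w : Measure (𝔼 × SPDMatrix d))
      = ∫⁻ i, ∫⁻ x, ‖(b + 𝐋 A (x - x₀)) - (i.1 + 𝐋 (α i.2).1 (x - x₀))‖ₑ ^ 2 ∂μ₀
        ∂(w : Measure (𝔼 × SPDMatrix d)) :=
    lintegral_congr fun i => hcost hA1 hA2 i
  replace hle := (hFη.symm.trans_le hle).trans_eq hFν
  rw [← hdec] at hle
  have hfin2 := ne_top_of_le_ne_top hfin' (le_add_self.trans_eq hdec)
  have hzero : ∫⁻ x, ‖T x - (b + 𝐋 A (x - x₀))‖ₑ ^ 2 ∂μ₀ = 0 := by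
    have := (ENNReal.add_le_add_iff_right hfin2).1 (hle.trans_eq (zero_add _).symm)
    exact nonpos_iff_eq_zero.1 this
  have hmeas : Measurable fun x => ‖T x - (b + 𝐋 A (x - x₀))‖ₑ ^ 2 :=
    (hT.measurable.sub hA1.measurable).enorm.pow_const 2
  rw [lintegral_eq_zero_iff hmeas] at hzero
  have hae : (fun x => b + 𝐋 A (x - x₀)) =ᵐ[μ₀] T := by
    filter_upwards [hzero] with x hx
    have : T x - (b + 𝐋 A (x - x₀)) = 0 := by simpa using hx
    exact (sub_eq_zero.1 this).symm
  refine ⟨(b, ⟨A * P * A, hA.mul_mul_self hP⟩), Subtype.ext ?_⟩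
  change multivariateGaussian b (A * P * A) = η
  rw [← hA1.map_eq, ← hT.map_eq]
  exact Measure.map_congr hae

/-! ## Density of the Gaussian mixtures -/

open Filter Topology in
theorem dense_linearMixtures_gaussianFamily : Dense (linearMixtures (gaussianFamily d)) := by
  intro η
  let r : ℕ → ℝ := fun n => 1 / ((n : ℝ) + 1)
  have hr0 : ∀ n, 0 < r n := fun n => Nat.one_div_pos_of_nat
  -- This is `r n ^ 2 • 1`, written as the covariance of the image of a standard Gaussian under `r n
  -- • 1`.
  let S : ℕ → SPDMatrix d := fun n => ⟨r n • (1 : Matrix (Fin d) (Fin d) ℝ) * 1 * (r n • 1),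
    (PosDef.one.smul (hr0 n)).mul_mul_self PosDef.one⟩
  let γ : Measure 𝔼 := multivariateGaussian 0 1
  let g : ℕ → 𝔼 × 𝔼 → 𝔼 := fun n q => q.1 + r n • q.2
  have hg : ∀ n, Measurable (g n) := fun n => by fun_prop
  let ν : ℕ → ProbabilityMeasure 𝔼 := fun n =>
    ⟨((η : Measure 𝔼).prod γ).map (g n), Measure.isProbabilityMeasure_map (hg n).aemeasurable⟩
  have hν : ∀ n, ν n ∈ linearMixtures (gaussianFamily d) := by
    intro n
    -- The weight is the law of `(X, S n)` with `X` distributed as `η`. For an embedding the change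
    -- of variables needs no measurability of the integrand.
    have he : MeasurableEmbedding fun x : 𝔼 => (x, S n) :=
      MeasurableEmbedding.id.prodMk_right (S n)
    refine ⟨⟨(η : Measure 𝔼).map fun x => (x, S n),
      Measure.isProbabilityMeasure_map he.measurable.aemeasurable⟩, fun s hs => ?_⟩
    change ((η : Measure 𝔼).prod γ).map (g n) s = ∫⁻ i, _ ∂((η : Measure 𝔼).map _)
    rw [he.lintegral_map, Measure.map_apply (hg n) hs, Measure.prod_apply (hg n hs)]
    refine lintegral_congr fun x => ?_
    change γ _ = multivariateGaussian x (r n • 1 * 1 * (r n • 1)) s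
    rw [← map_affine_multivariateGaussian 0 x PosSemidef.one
      (PosDef.one.smul (hr0 n)).isHermitian, Measure.map_apply (by fun_prop) hs]
    congr 1
    ext z
    simp [g]
  refine mem_closure_of_tendsto (f := ν) (b := atTop) ?_ (.of_forall hν)
  rw [ProbabilityMeasure.tendsto_iff_forall_integral_tendsto]
  intro f
  have hlim : ∫ x, f x ∂(η : Measure 𝔼) = ∫ q, f q.1 ∂((η : Measure 𝔼).prod γ) := by
    have := integral_map (μ := (η : Measure 𝔼).prod γ) measurable_fst.aemeasurable
      (f := f) (by fun_prop)
    rw [← this, ← Measure.fst, Measure.fst_prod]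
  rw [hlim]
  have hν2 : ∀ n, ∫ x, f x ∂(ν n : Measure 𝔼) = ∫ q, f (g n q) ∂((η : Measure 𝔼).prod γ) :=
    fun n => integral_map (hg n).aemeasurable (by fun_prop)
  simp_rw [hν2]
  refine tendsto_integral_of_dominated_convergence (fun _ => ‖f‖)
    (fun n => (f.continuous.measurable.comp (hg n)).aestronglyMeasurable)
    (integrable_const _) (fun n => .of_forall fun q => f.norm_coe_le_norm _)
    (.of_forall fun q => (f.continuous.tendsto _).comp ?_)
  have h1 : Tendsto r atTop (𝓝 0) := tendsto_one_div_add_atTop_nhds_zero_nat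
  have h2 := (h1.smul_const q.2).const_add q.1
  rwa [zero_smul, add_zero] at h2

theorem mainTheorem8 (d : ℕ) :
    w2BCM (gaussianFamily d) ⊆ Set.range (gaussianFamily d) ∧
    (∀ p₀ : EuclideanSpace ℝ (Fin d) × SPDMatrix d,
      lBCM (gaussianFamily d p₀) (gaussianFamily d) ⊆ Set.range (gaussianFamily d)) ∧
    Dense (linearMixtures (gaussianFamily d)) := by
  exact ⟨w2BCM_gaussianFamily_subset, lBCM_gaussianFamily_subset,
    dense_linearMixtures_gaussianFamily⟩
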